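/- **Theorem 4.1 ($M_{4B}$).** *Setting.* Consider tuples $(R,M,A,\langle\,,\rangle)$ where $R$ is an integral domain containing $\mathbb R$; $M$ is a commutative, not necessarily associative, $R$-algebra generated by six distinct marked elements $A=\{a_1,a_{-1},a_2,a_{-2},a_3,a_{-3}\}$; $\langle\,,\rangle$ is an $R$-valued bilinear form on $M$ with $\langle u,v\cdot w\rangle=\langle u\cdot v,w\rangle$; and $R$ is generated as an $\mathbb R$-algebra by the values of the form on the (non-associative) products of the marked generators. Morphisms are pairs consisting of an $\mathbb R$-algebra homomorphism $\varphi$ of coefficient rings and a $\varphi$-semilinear multiplicative map $\psi$ with $\langle \psi u,\psi v\rangle=\varphi(\langle u,v\rangle)$ that sends each marked generator to the corresponding one. Let $\mathcal C_{4B}$ be the class of those tuples for which: 1. each $a\in A$ is a primitive axis of Monster type with $\langle a,a\rangle=1$. That is, with $M_\lambda=\{v\in M: a\cdot v=\lambda v\}$: $a\cdot a=a$; $M=M_1\oplus M_0\oplus M_{1/4}\oplus M_{1/32}$; $M_1=Ra$; and $M_\lambda\cdot M_\mu\subseteq\bigoplus_{\nu\in\lambda*\mu}M_\nu$, where $*$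 is the symmetric Monster fusion rule $1*1=\{1\}$, $1*0=\emptyset$, $0*0=\{0\}$, $1*\mu=0*\mu=\{\mu\}$ for $\mu\in\{\frac14,\frac1{32}\}$, $\frac14*\frac14=\{1,0\}$, $\frac14*\frac1{32}=\{\frac1{32}\}$, $\frac1{32}*\frac1{32}=\{1,0,\frac14\}$; 2. for $i\in\{1,2,3\}$ the Miyamoto involutions $\tau(a_i)$ and $\tau(a_{-i})$ (where $\tau(a)$ is the identity on $M_1\oplus M_0\oplus M_{1/4}$ and $-1$ on $M_{1/32}$) both fix $a_i$ and $a_{-i}$, and both interchange $a_j$ and $a_{-j}$ for each $j\in\{1,2,3\}\setminus\{i\}$; 3. (shape $4B$) the subalgebra generated by $a_1$ and $a_2$ is the dihedral algebra of type $4B$: it is free with basis $a_1,a_{-1},a_2,a_{-2},c$ for some $c$, these five elements are idempotents, and for $i,j\in\{\pm1,\pm2\}$ with $|i|\ne|j|$ $$a_i\cdot a_j=\tfrac1{64}(a_i+a_j-a_{-i}-a_{-j}+c),\quad a_i\cdot a_{-i}=\tfrac18(a_i+a_{-i}-c),\quad a_i\cdot c=\tfrac18(a_i+c-a_{-i}),$$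 $$\langle a_i,a_j\rangle=\tfrac1{64},\quad \langle a_i,a_{-i}\rangle=\langle a_i,c\rangle=\tfrac18,\quad \langle a_i,a_i\rangle=\langle c,c\rangle=1.$$ A universal algebra of shape $4B$ is a member of $\mathcal C_{4B}$ of which every member of $\mathcal C_{4B}$ is a quotient, by a unique morphism (surjective both on the algebra and on the coefficient ring). *Claim.* A universal algebra $M_{4B}$ of shape $4B$ exists. For every such algebra, its coefficient ring is $\mathbb R$ (the inclusion of $\mathbb R$ into it is bijective), and $M_{4B}$ is $7$-dimensional, with basis $$a_1,\ a_{-1},\ a_2,\ a_{-2},\ a_3,\ a_{-3},\ a_\rho,\qquad a_\rho:=a_1+a_{-1}-8\,a_1\cdot a_{-1}.$$ -/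

import Mathlib

universe u v

/-- Labels for the four elements `1, 0, 1/4, 1/32` of the Monster fusion rule. -/
inductive MonsterLabel : Type
  | one | zero | quarter | thirtySecond
  deriving DecidableEq

namespace MonsterLabel

/-- The number named by a label. -/
noncomputable def val : MonsterLabel → ℝ
  | one => 1
  | zero => 0
  | quarter => 1 / 4
  | thirtySecond => 1 / 32

/-- The Monster (Majorana) fusion rule. -/
def star : MonsterLabel → MonsterLabel → Set MonsterLabel
  | one, one => {one}
  | one, zero => ∅
  | one, quarter => {quarter}
  | one, thirtySecond => {thirtySecond}
  | zero, one => ∅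
  | zero, zero => {zero}
  | zero, quarter => {quarter}
  | zero, thirtySecond => {thirtySecond}
  | quarter, one => {quarter}
  | quarter, zero => {quarter}
  | quarter, quarter => {one, zero}
  | quarter, thirtySecond => {thirtySecond}
  | thirtySecond, one => {thirtySecond}
  | thirtySecond, zero => {thirtySecond}
  | thirtySecond, quarter => {thirtySecond}
  | thirtySecond, thirtySecond => {one, zero, quarter}

end MonsterLabel

section Axes

variable (R : Type*) {M : Type*} [CommRing R] [Algebra ℝ R] [NonUnitalNonAssocCommRing M]
  [Module R M] [SMulCommClass R M M] [IsScalarTower R M M]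

/-- The eigenspace of the adjoint map `v ↦ a * v` for the eigenvalue named by the label `l`. -/
noncomputable def adEigenspace (a : M) (l : MonsterLabel) : Submodule R M :=
  Module.End.eigenspace (LinearMap.mulLeft R a) (algebraMap ℝ R l.val)

/-- The sum of the eigenspaces of the adjoint map of `a` over a set of labels. -/
noncomputable def adEigenspaces (a : M) (s : Set MonsterLabel) : Submodule R M :=
  ⨆ l ∈ s, adEigenspace R a l

/-- `a` is an idempotent, `M` is the direct sum of the eigenspaces of its adjoint map for the
eigenvalues `1, 0, 1/4, 1/32`, and these eigenspaces obey the Monster fusion rule. -/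
structure IsMonsterAxis (a : M) : Prop where
  idem : a * a = a
  semisimple : DirectSum.IsInternal (adEigenspace R a)
  fusion : ∀ (l m : MonsterLabel), ∀ u ∈ adEigenspace R a l, ∀ v ∈ adEigenspace R a m,
    u * v ∈ adEigenspaces R a (MonsterLabel.star l m)

/-- The axis `a` is primitive: its `1`-eigenspace is spanned by `a`. -/
def IsPrimitiveAxis (a : M) : Prop :=
  adEigenspace R a .one = Submodule.span R {a}

/-- `τ` is the Miyamoto involution of the axis `a`. (As `M` is the direct sum of the eigenspaces
of an axis, there is exactly one such map for each axis.) -/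
structure IsMiyamotoInvolution (a : M) (τ : M ≃ₗ[R] M) : Prop where
  map_even : ∀ v ∈ adEigenspaces R a {.one, .zero, .quarter}, τ v = v
  map_odd : ∀ v ∈ adEigenspace R a .thirtySecond, τ v = -v

/-- The subalgebra generated by `a₀` and `a₁` is a dihedral algebra of type `4B`, where `am₁` is
the image of `a₁` under the Miyamoto involution of `a₀`, and `a₂` that of `a₀` under the one of
`a₁`: it has a basis `am₁, a₀, a₁, a₂, c` with the products and the values of the form of the
dihedral algebra of type `4B`. -/
def IsDihedral4B (form : LinearMap.BilinForm R M) (a₀ a₁ am₁ a₂ : M) : Prop :=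
  ∃ c : M,
    LinearIndependent R ![am₁, a₀, a₁, a₂, c] ∧
    Submodule.span R {am₁, a₀, a₁, a₂, c} =
      (NonUnitalAlgebra.adjoin R {a₀, a₁}).toSubmodule ∧
    -- the five basis vectors are idempotents
    (am₁ * am₁ = am₁ ∧ a₀ * a₀ = a₀ ∧ a₁ * a₁ = a₁ ∧ a₂ * a₂ = a₂ ∧ c * c = c) ∧
    -- products of neighbouring axes
    ((64 : R) • (a₀ * a₁) = a₀ + a₁ - am₁ - a₂ + c ∧
      (64 : R) • (a₀ * am₁) = a₀ + am₁ - a₁ - a₂ + c ∧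
      (64 : R) • (a₂ * a₁) = a₂ + a₁ - am₁ - a₀ + c ∧
      (64 : R) • (a₂ * am₁) = a₂ + am₁ - a₁ - a₀ + c) ∧
    -- the two subalgebras of type 2A, which share the vector `c`
    ((8 : R) • (a₀ * a₂) = a₀ + a₂ - c ∧ (8 : R) • (a₁ * am₁) = a₁ + am₁ - c ∧
      (8 : R) • (a₀ * c) = a₀ + c - a₂ ∧ (8 : R) • (a₂ * c) = a₂ + c - a₀ ∧
      (8 : R) • (a₁ * c) = a₁ + c - am₁ ∧ (8 : R) • (am₁ * c) = am₁ + c - a₁) ∧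
    -- the form
    (form am₁ am₁ = 1 ∧ form a₀ a₀ = 1 ∧ form a₁ a₁ = 1 ∧ form a₂ a₂ = 1 ∧ form c c = 1) ∧
    (form a₀ a₁ = algebraMap ℝ R (1 / 64) ∧ form a₀ am₁ = algebraMap ℝ R (1 / 64) ∧
      form a₂ a₁ = algebraMap ℝ R (1 / 64) ∧ form a₂ am₁ = algebraMap ℝ R (1 / 64)) ∧
    (form a₀ a₂ = algebraMap ℝ R (1 / 8) ∧ form a₁ am₁ = algebraMap ℝ R (1 / 8) ∧
      form a₀ c = algebraMap ℝ R (1 / 8) ∧ form a₂ c = algebraMap ℝ R (1 / 8) ∧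
      form a₁ c = algebraMap ℝ R (1 / 8) ∧ form am₁ c = algebraMap ℝ R (1 / 8))

end Axes

/-- A commutative, not necessarily associative, algebra `M` over a coefficient ring `R`, an
integral domain containing `ℝ`, with a bilinear form that associates with the product, and with
generators marked by `ι`. The coefficient ring is generated over `ℝ` by the values of the form on
the products of the marked generators. -/
structure MarkedFrobeniusAlgebra (ι : Type) : Type (u + 1) where
  R : Type u
  M : Type u
  [commRing : CommRing R]
  [isDomain : IsDomain R]
  [realAlgebra : Algebra ℝ R]
  [mulRing : NonUnitalNonAssocCommRing M]
  [module : Module R M]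
  [smulComm : SMulCommClass R M M]
  [scalarTower : IsScalarTower R M M]
  gen : ι → M
  form : LinearMap.BilinForm R M
  form_assoc : ∀ u v w : M, form u (v * w) = form (u * v) w
  adjoin_gen : NonUnitalAlgebra.adjoin R (Set.range gen) = ⊤
  adjoin_form : Algebra.adjoin ℝ {r : R | ∃ x ∈ Subsemigroup.closure (Set.range gen),
    ∃ y ∈ Subsemigroup.closure (Set.range gen), r = form x y} = ⊤

namespace MarkedFrobeniusAlgebra

attribute [instance] commRing isDomain realAlgebra mulRing module smulComm scalarTower

/-- A morphism: an `ℝ`-algebra map of coefficient rings and a compatible additive map of algebras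
that preserves the product, the form and the marked generators. -/
@[ext] structure Hom {ι : Type} (𝓐 : MarkedFrobeniusAlgebra.{u} ι)
    (𝓑 : MarkedFrobeniusAlgebra.{v} ι) : Type (max u v) where
  ringMap : 𝓐.R →ₐ[ℝ] 𝓑.R
  map : 𝓐.M →+ 𝓑.M
  map_smul : ∀ (r : 𝓐.R) (x : 𝓐.M), map (r • x) = ringMap r • map x
  map_mul : ∀ x y : 𝓐.M, map (x * y) = map x * map y
  map_form : ∀ x y : 𝓐.M, 𝓑.form (map x) (map y) = ringMap (𝓐.form x y)
  map_gen : ∀ i : ι, map (𝓐.gen i) = 𝓑.gen i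

end MarkedFrobeniusAlgebra

/-- Labels of the six axes: `(i, 1)` stands for `a_{i+1}` and `(i, -1)` for `a_{-(i+1)}`. -/
abbrev AxisIndex : Type := Fin 3 × ℤˣ

/-- The permutation of the labels induced by the Miyamoto involution of the axis labelled `i`:
it fixes `a_{±k}` for the `k` of that axis, and negates the index of the four other axes. -/
def axisPerm (i j : AxisIndex) : AxisIndex :=
  if j.1 = i.1 then j else (j.1, -j.2)

/-- Primitive Frobenius axial algebras of Monster type, generated by six marked axes
`a_{±1}, a_{±2}, a_{±3}` that are permuted by their Miyamoto involutions as prescribed,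
and of shape `4B`. -/
structure IsShape4B (𝓐 : MarkedFrobeniusAlgebra.{u} AxisIndex) : Prop where
  gen_injective : Function.Injective 𝓐.gen
  axis : ∀ i, IsMonsterAxis 𝓐.R (𝓐.gen i)
  primitive : ∀ i, IsPrimitiveAxis 𝓐.R (𝓐.gen i)
  form_axis : ∀ i, 𝓐.form (𝓐.gen i) (𝓐.gen i) = 1
  miyamoto : ∀ i, ∃ τ : 𝓐.M ≃ₗ[𝓐.R] 𝓐.M, IsMiyamotoInvolution 𝓐.R (𝓐.gen i) τ ∧
    ∀ j, τ (𝓐.gen j) = 𝓐.gen (axisPerm i j)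
  shape : IsDihedral4B 𝓐.R 𝓐.form
    (𝓐.gen (0, 1)) (𝓐.gen (1, 1)) (𝓐.gen (1, -1)) (𝓐.gen (0, -1))

/-- `𝓐` is a universal algebra of shape `4B`: it has shape `4B`, and every algebra of shape `4B`
is a quotient of it, by a unique morphism. -/
def IsUniversal4B (𝓐 : MarkedFrobeniusAlgebra.{u} AxisIndex) : Prop :=
  IsShape4B 𝓐 ∧ ∀ 𝓑 : MarkedFrobeniusAlgebra.{v} AxisIndex, IsShape4B 𝓑 →
    ∃ f : MarkedFrobeniusAlgebra.Hom 𝓐 𝓑, Function.Surjective f.ringMap ∧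
      Function.Surjective f.map ∧ ∀ g : MarkedFrobeniusAlgebra.Hom 𝓐 𝓑, g = f

/-- The vector `a_ρ = a_1 + a_{-1} - 8 a_1 a_{-1}`. -/
def aRho (𝓐 : MarkedFrobeniusAlgebra.{u} AxisIndex) : 𝓐.M :=
  𝓐.gen (0, 1) + 𝓐.gen (0, -1) - (8 : 𝓐.R) • (𝓐.gen (0, 1) * 𝓐.gen (0, -1))

/-! Every algebra of the class is a copy of one explicit real algebra, `Model4B`; the fusion rule
forces this. Let `a, a'` and `b, b'` be two of the pairs `a_i, a_{-i}`. Since the involution of `a`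
swaps `b` and `b'`, the components of `b` for the eigenvalues `0` and `1/4` can be written with `a`,
`b`, `b'` and `a * b` (`fusion_of_axis_pair`). The fusion rule constrains the products of these
components. Solving the constraints (`fusion_resurrection`) expresses `a * (b * b')` and `s * s`,
where `s = a * b - (a + b) / 32`, through `s`, the axes, `a * a'`, `b * b'` and the values `L = ⟨a,
b⟩`, `m = ⟨b, b'⟩`.

The vector `s` is unchanged when `a` and `a'`, or `b` and `b'`, or the two pairs are exchanged, but
the formula for `s * s` is not visibly symmetric. Given `⟨a, a'⟩ = 1/8`, comparing its versions
forces `L = 1/64` and `m = 1/8` and determines `b * b'` (`form_eq`). If moreover `a, a'` satisfy the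
`2A` relations with third vector `c`, then so do `b, b'` with the same `c`, and `a * b` follows
(`dihedral4B`).

The shape provides the `2A` relations for `a_{±1}`; carrying them to the other pairs gives all
products and form values of the six axes and `c = a_ρ` (`IsShape4B.exists_table`). The span of these
seven vectors is closed under multiplication, so the table yields a morphism from the model
(`HasTable4B.hom`). It is surjective because the marked elements and the form values generate, and
injective because it preserves the form, which is positive definite on the model. That the model
itself belongs to the class is a computation with the idempotents `f_i`, `a_ρ` and the differences
`d_i = a_i - a_{-i}`, in which the product is almost diagonal. -/

set_option linter.unusedSectionVars false

/-! ### Eigenvectors of a primitive axis and the form. -/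

section AxisLemmas

variable {R : Type*} {M : Type*} [CommRing R] [Algebra ℝ R] [NonUnitalNonAssocCommRing M]
  [Module R M] [SMulCommClass R M M] [IsScalarTower R M M]

/-- Because `R` contains `ℝ`, denominators can be cleared and cancelled again; most identities below
carry integer coefficients, so that `module` and `linear_combination` apply. -/
theorem isUnit_natCast_of_real {n : ℕ} (hn : n ≠ 0) : IsUnit (n : R) := by
  have h : IsUnit (n : ℝ) := isUnit_iff_ne_zero.2 (Nat.cast_ne_zero.2 hn)
  simpa using h.map (algebraMap ℝ R)

variable (R) in
theorem smul_cancel_of_real {n : ℕ} (hn : n ≠ 0) {x y : M}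
    (h : (n : R) • x = (n : R) • y) : x = y :=
  (isUnit_natCast_of_real hn).smul_left_cancel.1 h

theorem mul_cancel_of_real {n : ℕ} (hn : n ≠ 0) {x y : R}
    (h : (n : R) * x = (n : R) * y) : x = y :=
  (isUnit_natCast_of_real hn).mul_left_cancel h

theorem nsmul_algebraMap_inv {n : ℕ} (hn : n ≠ 0) (x : M) :
    (n : R) • (algebraMap ℝ R (1 / n) • x) = x := by
  rw [smul_smul, ← map_natCast (algebraMap ℝ R) n, ← map_mul]
  have : (n : ℝ) ≠ 0 := Nat.cast_ne_zero.2 hn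
  rw [mul_one_div_cancel this, map_one, one_smul]

theorem mem_adEigenspace_iff {a v : M} {l : MonsterLabel} :
    v ∈ adEigenspace R a l ↔ a * v = algebraMap ℝ R l.val • v := by
  simp [adEigenspace]

theorem mem_adEigenspace_one {a v : M} : v ∈ adEigenspace R a .one ↔ a * v = v := by
  simp [mem_adEigenspace_iff, MonsterLabel.val]

theorem mem_adEigenspace_zero {a v : M} : v ∈ adEigenspace R a .zero ↔ a * v = 0 := by
  simp [mem_adEigenspace_iff, MonsterLabel.val]

theorem mem_adEigenspace_quarter {a v : M} :
    v ∈ adEigenspace R a .quarter ↔ (4 : R) • (a * v) = v := by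
  have h := nsmul_algebraMap_inv (R := R) (n := 4) (by norm_num) v
  rw [mem_adEigenspace_iff, MonsterLabel.val]
  push_cast at h
  constructor
  · intro h'; rw [h', h]
  · intro h'
    apply smul_cancel_of_real R (n := 4) (by norm_num)
    push_cast
    rw [h', h]

theorem mem_adEigenspace_thirtySecond {a v : M} :
    v ∈ adEigenspace R a .thirtySecond ↔ (32 : R) • (a * v) = v := by
  have h := nsmul_algebraMap_inv (R := R) (n := 32) (by norm_num) v
  rw [mem_adEigenspace_iff, MonsterLabel.val]
  push_cast at h
  constructor
  · intro h'; rw [h', h]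
  · intro h'
    apply smul_cancel_of_real R (n := 32) (by norm_num)
    push_cast
    rw [h', h]

theorem adEigenspaces_singleton (a : M) (l : MonsterLabel) :
    adEigenspaces R a {l} = adEigenspace R a l := by
  simp [adEigenspaces]

theorem adEigenspaces_pair (a : M) (l m : MonsterLabel) :
    adEigenspaces R a {l, m} = adEigenspace R a l ⊔ adEigenspace R a m := by
  simp only [adEigenspaces, iSup_insert, iSup_singleton]

theorem adEigenspace_le {a : M} {l : MonsterLabel} {s : Set MonsterLabel} (h : l ∈ s) :
    adEigenspace R a l ≤ adEigenspaces R a s :=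
  le_iSup₂_of_le l h le_rfl

/-- Decomposition of a vector into eigenvectors of a primitive axis. -/
theorem exists_eigen_decomposition {a : M} (ha : IsMonsterAxis R a) (hp : IsPrimitiveAxis R a)
    (v : M) : ∃ (r : R) (v₀ v₄ v₃₂ : M), v = r • a + v₀ + v₄ + v₃₂ ∧ a * v₀ = 0 ∧
      (4 : R) • (a * v₄) = v₄ ∧ (32 : R) • (a * v₃₂) = v₃₂ := by
  have htop := ha.semisimple.submodule_iSup_eq_top
  have hv : v ∈ ⨆ l, adEigenspace R a l := htop ▸ Submodule.mem_top
  have hsup : ⨆ l, adEigenspace R a l = adEigenspace R a .one ⊔ adEigenspace R a .zero ⊔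
      adEigenspace R a .quarter ⊔ adEigenspace R a .thirtySecond := by
    apply le_antisymm
    · refine iSup_le fun l => ?_
      cases l
      · exact le_sup_of_le_left (le_sup_of_le_left le_sup_left)
      · exact le_sup_of_le_left (le_sup_of_le_left le_sup_right)
      · exact le_sup_of_le_left le_sup_right
      · exact le_sup_right
    · simp only [sup_le_iff]
      exact ⟨⟨⟨le_iSup (adEigenspace R a) _, le_iSup (adEigenspace R a) _⟩,
        le_iSup (adEigenspace R a) _⟩, le_iSup (adEigenspace R a) _⟩
  rw [hsup] at hv
  obtain ⟨w, hw, v₃₂, h₃₂, h1⟩ := Submodule.mem_sup.1 hv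
  obtain ⟨w', hw', v₄, h₄, h2⟩ := Submodule.mem_sup.1 hw
  obtain ⟨w'', hw'', v₀, h₀, h3⟩ := Submodule.mem_sup.1 hw'
  rw [hp] at hw''
  obtain ⟨r, rfl⟩ := Submodule.mem_span_singleton.1 hw''
  exact ⟨r, v₀, v₄, v₃₂, by rw [← h1, ← h2, ← h3], mem_adEigenspace_zero.1 h₀, mem_adEigenspace_quarter.1 h₄,
    mem_adEigenspace_thirtySecond.1 h₃₂⟩

section Form

variable {form : LinearMap.BilinForm R M}
  (hform : ∀ u v w : M, form u (v * w) = form (u * v) w)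

include hform

/-- Associativity and `a * a = a` give `⟨a, a * v⟩ = ⟨a, v⟩`, so an eigenvalue `k / n ≠ 1` forces
`⟨a, v⟩ = 0`. The form is not assumed symmetric, hence the two halves. -/
theorem form_axis_eq_zero {a v : M} (haa : a * a = a) {n k : ℕ} (hk : k < n)
    (hv : (n : R) • (a * v) = (k : R) • v) : form a v = 0 ∧ form v a = 0 := by
  have h1 : (n : R) * form a v = k * form a v := by
    rw [← smul_eq_mul, ← smul_eq_mul, ← map_smul, ← map_smul, ← hv, map_smul, map_smul, hform, haa]
  have h2 : (n : R) * form v a = k * form v a := by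
    have : (n : R) * form v a = form ((n : R) • (a * v)) a := by
      rw [map_smul, LinearMap.smul_apply, smul_eq_mul, mul_comm a v, ← hform, haa]
    rw [this, hv, map_smul, LinearMap.smul_apply, smul_eq_mul]
  have hc : (n : R) = ((n - k : ℕ) : R) + k := by
    rw [← Nat.cast_add, Nat.sub_add_cancel hk.le]
  have hne : n - k ≠ 0 := by omega
  constructor
  · apply mul_cancel_of_real hne
    linear_combination h1 - form a v * hc
  · apply mul_cancel_of_real hne
    linear_combination h2 - form v a * hc

theorem form_orthogonal {a u v : M} (hu : (4 : R) • (a * u) = u) (hv : (32 : R) • (a * v) = v) :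
    form u v = 0 := by
  have h1 : (4 : R) * form u (a * v) = form u v := by
    rw [hform, mul_comm u a, ← smul_eq_mul, ← LinearMap.smul_apply, ← map_smul, hu]
  have h2 : (32 : R) * form u (a * v) = form u v := by
    rw [← smul_eq_mul, ← map_smul, hv]
  have h3 : ((7 : ℕ) : R) * form u v = ((7 : ℕ) : R) * 0 := by
    push_cast
    linear_combination h2 - 8 * h1
  exact mul_cancel_of_real (by norm_num) h3

/-- Only the multiple of `a` in `v` contributes, on either side. This replaces symmetry of the form
wherever one argument is an axis. -/
theorem form_axis_comm {a : M} (ha : IsMonsterAxis R a) (hp : IsPrimitiveAxis R a) (v : M) :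
    form a v = form v a := by
  obtain ⟨r, v₀, v₄, v₃₂, rfl, h₀, h₄, h₃₂⟩ := exists_eigen_decomposition ha hp v
  have e0 := form_axis_eq_zero hform ha.idem (n := 1) (k := 0) (v := v₀) (by norm_num) (by simp [h₀])
  have e4 := form_axis_eq_zero hform ha.idem (n := 4) (k := 1) (v := v₄) (by norm_num)
    (by simpa using h₄)
  have e32 := form_axis_eq_zero hform ha.idem (n := 32) (k := 1) (v := v₃₂) (by norm_num)
    (by simpa using h₃₂)
  simp [e0.1, e0.2, e4.1, e4.2, e32.1, e32.2]

/-- The fusion rule of a primitive axis `a`, applied to the components of an idempotent `b`. Here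
`64 (a * b) - 64 ⟨a, b⟩ a - (b - b')` is `16` times the component of `b` for `1 / 4`. -/
theorem fusion_of_axis_pair {a b b' : M} {τ : M ≃ₗ[R] M} (ha : IsMonsterAxis R a)
    (hp : IsPrimitiveAxis R a) (haa : form a a = 1) (hτ : IsMiyamotoInvolution R a τ)
    (hτb : τ b = b') (hb : b * b = b) (hbb : form b b = 1) {L m : R} (hL : form a b = L)
    (hm : form b' b = m) {Q Z : M} (hQ : Q = (64 : R) • (a * b) - (64 * L) • a - (b - b'))
    (hZ : Z = (8 : R) • (b + b') - (16 * L) • a - Q) :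
    (32 : R) • (a * b) - (32 : R) • (a * b') = b - b' ∧ form a (b - b') = 0 ∧
    (4 : R) • (a * Q) = Q ∧ a * Z = 0 ∧ (4 : R) • (a * (Z * Q)) = Z * Q ∧ a * (Z * Z) = 0 ∧
    a * (Q * Q) = (256 * L - 256 * L ^ 2 - 4 * (1 - m)) • a := by
  obtain ⟨r, v₀, v₄, v₃₂, hv, h₀, h₄, h₃₂⟩ := exists_eigen_decomposition ha hp b
  have e0 := form_axis_eq_zero hform ha.idem (n := 1) (k := 0) (v := v₀) (by norm_num) (by simp [h₀])
  have e4 := form_axis_eq_zero hform ha.idem (n := 4) (k := 1) (v := v₄) (by norm_num)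
    (by simpa using h₄)
  have e32 := form_axis_eq_zero hform ha.idem (n := 32) (k := 1) (v := v₃₂) (by norm_num)
    (by simpa using h₃₂)
  have hr : r = L := by
    rw [← hL, hv]; simp [haa, e0.1, e4.1, e32.1]
  subst hr
  have hb' : b' = r • a + v₀ + v₄ - v₃₂ := by
    have t1 : τ a = a := hτ.map_even _ (adEigenspace_le (l := .one) (by simp)
      (mem_adEigenspace_one.2 ha.idem))
    have t2 : τ v₀ = v₀ := hτ.map_even _ (adEigenspace_le (l := .zero) (by simp)
      (mem_adEigenspace_zero.2 h₀))
    have t3 : τ v₄ = v₄ := hτ.map_even _ (adEigenspace_le (l := .quarter) (by simp)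
      (mem_adEigenspace_quarter.2 h₄))
    have t4 : τ v₃₂ = -v₃₂ := hτ.map_odd _ (mem_adEigenspace_thirtySecond.2 h₃₂)
    rw [← hτb, hv, map_add, map_add, map_add, map_smul, t1, t2, t3, t4, sub_eq_add_neg]
  have hd : b - b' = (2 : R) • v₃₂ := by rw [hv, hb']; module
  have hab : a * b = r • a + a * v₄ + a * v₃₂ := by
    rw [hv]; simp only [mul_add, mul_smul_comm, ha.idem, h₀]; module
  have hab' : a * b' = r • a + a * v₄ - a * v₃₂ := by
    rw [hb']; simp only [mul_add, mul_sub, mul_smul_comm, ha.idem, h₀]; module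
  have hQ4 : Q = (16 : R) • v₄ := by
    rw [hQ, hab, hd]
    linear_combination (norm := module) (16 : R) • h₄ + (2 : R) • h₃₂
  have hZ0 : Z = (16 : R) • v₀ := by
    rw [hZ, hQ4, hv, hb']; module
  have hQm : Q ∈ adEigenspace R a .quarter := by
    rw [hQ4]; exact Submodule.smul_mem _ _ (mem_adEigenspace_quarter.2 h₄)
  have hZm : Z ∈ adEigenspace R a .zero := by
    rw [hZ0]; exact Submodule.smul_mem _ _ (mem_adEigenspace_zero.2 h₀)
  have f1 := ha.fusion _ _ _ hZm _ hQm
  have f2 := ha.fusion _ _ _ hZm _ hZm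
  have f3 := ha.fusion _ _ _ hQm _ hQm
  simp only [MonsterLabel.star, adEigenspaces_singleton, adEigenspaces_pair] at f1 f2 f3
  have hQ' := mem_adEigenspace_quarter.1 hQm
  refine ⟨?_, ?_, hQ', mem_adEigenspace_zero.1 hZm, mem_adEigenspace_quarter.1 f1,
    mem_adEigenspace_zero.1 f2, ?_⟩
  · rw [hab, hab', hd]
    linear_combination (norm := module) (2 : R) • h₃₂
  · simp [hd, e32.1]
  obtain ⟨w, hw, z, hz, hwz⟩ := Submodule.mem_sup.1 f3
  rw [hp] at hw
  obtain ⟨k, rfl⟩ := Submodule.mem_span_singleton.1 hw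
  rw [mem_adEigenspace_zero] at hz
  have ez := form_axis_eq_zero hform ha.idem (n := 1) (k := 0) (v := z) (by norm_num) (by simp [hz])
  -- By associativity `k = ⟨a, Q * Q⟩ = ⟨a * Q, Q⟩ = ⟨Q, Q⟩ / 4`. As `Q` is orthogonal to `a` and `b
  -- - b'`, also `⟨Q, Q⟩ = 64 ⟨Q, a * b⟩ = 16 ⟨Q, b⟩`, which is computable from `L` and `m`.
  have hk : form (a * Q) Q = k := by
    rw [← hform, ← hwz]; simp [haa, ez.1]
  have hQQ : form Q Q = 4 * k := by
    rw [← hk, ← smul_eq_mul, ← LinearMap.smul_apply, ← map_smul, hQ']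
  have hQa : form Q a = 0 := by rw [hQ4]; simp [e4.2]
  have hQd : form Q (b - b') = 0 := by
    rw [hQ4, hd]; simp [form_orthogonal hform h₄ h₃₂]
  have hQab : 4 * form Q (a * b) = form Q b := by
    rw [hform, mul_comm Q a, ← smul_eq_mul, ← LinearMap.smul_apply, ← map_smul, hQ']
  have hQQ' : form Q Q = 64 * form Q (a * b) := by
    have : form Q Q = form Q ((64 : R) • (a * b) - (64 * r) • a - (b - b')) := by rw [← hQ]
    rw [this, map_sub, map_sub, map_smul, map_smul, hQd, hQa]
    simp
  have hQb : form Q b = 64 * r - 64 * r * r - (1 - m) := by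
    rw [hQ]
    simp [← hform, hb, hL, hbb, hm]
  have : k = 256 * r - 256 * r ^ 2 - 4 * (1 - m) := by
    apply mul_cancel_of_real (n := 4) (by norm_num)
    push_cast
    linear_combination -hQQ + hQQ' + 16 * hQab + 16 * hQb
  rw [← this, ← hwz, mul_add, hz, mul_smul_comm, ha.idem, add_zero]

end Form
end AxisLemmas

/-! ### The resurrection principle. -/

section Dihedral

variable {R : Type*} {M : Type*} [CommRing R] [Algebra ℝ R] [NonUnitalNonAssocCommRing M]
  [Module R M] [SMulCommClass R M M] [IsScalarTower R M M]

/-- The resurrection principle for an axis `a`: if `B` is the sum of two idempotents with product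
`t`, and `A` is the sum of `a` and another idempotent, with `a * A = a + x`, then the fusion rule
determines `a * t` and `s * s`. -/
theorem fusion_resurrection {a A B s t x Q Z : M} {L m : R} (haa : a * a = a)
    (haB : (32 : R) • (a * B) = (64 : R) • s + (2 : R) • a + B) (hBB : B * B = B + (2 : R) • t)
    (hsB : (2048 : R) • (s * B) = (896 : R) • s + (1536 * L - 50) • B + (14 : R) • A)
    (has : (2048 : R) • (a * s) = (448 : R) • s + (1536 * L - 50) • a + (7 : R) • B)
    (haA : a * A = a + x) (hQ : Q = (64 : R) • s + (2 - 64 * L) • a + B)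
    (hZ : Z = (8 : R) • B - (16 * L) • a - Q)
    (h1 : (4 : R) • (a * (Z * Q)) = Z * Q) (h2 : a * (Z * Z) = 0)
    (h3 : a * (Q * Q) = (256 * L - 256 * L ^ 2 - 4 * (1 - m)) • a) :
    (192 : R) • (a * t) = (2048 * L - 64) • s + (-2048 * L ^ 2 + 320 * L - 8 * m - 8) • a +
      (32 * L - 1) • B + (14 : R) • x ∧
    (98304 : R) • (s * s) = (-40960 * L - 832) • s +
      (114688 * L ^ 2 - 1792 * L + 448 * m - 56) • a + (63 : R) • A + (6272 * L - 133) • B +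
      (336 : R) • t - (448 : R) • x := by
  -- `P = Z + Q` does not involve `s`, so `P * P` and `P * Q` avoid the unknown `s * s`.
  obtain ⟨P, hP⟩ : ∃ P, P = (8 : R) • B - (16 * L) • a := ⟨_, rfl⟩
  have hZQ : Z * Q = P * Q - Q * Q := by rw [hZ, hP]; simp only [sub_mul]
  have hZZ : Z * Z = P * P - (2 : R) • (P * Q) + Q * Q := by
    rw [hZ, ← hP]; simp only [sub_mul, mul_sub, mul_comm Q P]; module
  have hPQ : (256 : R) • (P * Q) = (64 : R) • ((896 : R) • s + (1536 * L - 50) • B + (14 : R) • A)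
      + (8 * (16 - 528 * L)) • ((64 : R) • s + (2 : R) • a + B) + (2048 : R) • (B + (2 : R) • t)
      - (128 * L) • ((448 : R) • s + (1536 * L - 50) • a + (7 : R) • B)
      - (4096 * L * (2 - 64 * L)) • a := by
    rw [hP, hQ]
    simp only [mul_add, sub_mul, smul_mul_assoc, mul_smul_comm, hBB, haa, mul_comm B a,
      mul_comm B s]
    linear_combination (norm := module) (64 : R) • hsB + (8 * (16 - 528 * L)) • haB -
      (128 * L) • has
  have haPQ := congrArg (a * ·) hPQ
  simp only [mul_add, mul_sub, mul_smul_comm, haa, haA] at haPQ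
  have hPP : P * P = (64 : R) • (B + (2 : R) • t) - (256 * L) • (a * B) + (256 * L ^ 2) • a := by
    rw [hP]
    simp only [mul_sub, sub_mul, smul_mul_assoc, mul_smul_comm, hBB, haa, mul_comm B a]
    module
  have haaB := congrArg (a * ·) haB
  simp only [mul_add, mul_smul_comm, haa] at haaB
  have haPP := congrArg (a * ·) hPP
  simp only [mul_add, mul_sub, mul_smul_comm, haa] at haPP
  rw [hZZ] at h2
  rw [hZQ] at h1
  simp only [mul_add, mul_sub, mul_smul_comm] at h1 h2
  -- In `a * (P * P) - 2 a * (P * Q) + a * (Q * Q) = 0` the last term is known by `h3`, and `t`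
  -- enters `P * P` with coefficient `128` and `P * Q` with `16`. So `96 (a * t)` is the only
  -- unknown.
  have hat : (192 : R) • (a * t) = (2048 * L - 64) • s +
      (-2048 * L ^ 2 + 320 * L - 8 * m - 8) • a + (32 * L - 1) • B + (14 : R) • x := by
    apply smul_cancel_of_real R (n := 128) (by norm_num)
    push_cast
    linear_combination (norm := module) (256 : R) • h2 - (256 : R) • haPP + (2 : R) • haPQ -
      (256 : R) • h3 + (2048 * L) • haaB + (64 - 256 * L) • has + (5888 * L - 576) • haB
  refine ⟨hat, ?_⟩
  -- The `1/4` rule for `Z * Q = P * Q - Q * Q` reads `Q * Q = P * Q - 4 a * (P * Q) + 4 a * (Q *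
  -- Q)`, with known right side; expanding `Q * Q` isolates `s * s`.
  have hQQ : Q * Q = (4096 : R) • (s * s) + (128 * (2 - 64 * L)) • (a * s) +
      (128 : R) • (s * B) + ((2 - 64 * L) ^ 2) • a + (2 * (2 - 64 * L)) • (a * B) +
      B + (2 : R) • t := by
    rw [hQ]
    simp only [mul_add, add_mul, smul_mul_assoc, mul_smul_comm, hBB, haa, mul_comm B a,
      mul_comm B s, mul_comm s a]
    module
  apply smul_cancel_of_real R (n := 32) (by norm_num)
  push_cast
  linear_combination (norm := module) (768 : R) • h1 - (768 : R) • hQQ - (12 : R) • haPQ +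
    (3 : R) • hPQ - (256 : R) • hat - (48 : R) • hsB - (32 * (15 - 156 * L)) • has -
    (32 * (996 * L - 9)) • haB + (3072 : R) • h3

end Dihedral

/-! ### Two pairs of axes, each interchanged by the involutions of the other. -/

section Quad

variable {R : Type*} {M : Type*} [CommRing R] [Algebra ℝ R] [NonUnitalNonAssocCommRing M]
  [Module R M] [SMulCommClass R M M] [IsScalarTower R M M]

/-- Primitive axes `a, a', b, b'` such that the Miyamoto involutions of `a` and `a'` interchange
`b` and `b'`, and those of `b` and `b'` interchange `a` and `a'`. -/
structure IsMiyamotoQuad (form : LinearMap.BilinForm R M) (a a' b b' : M) : Prop where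
  axis : ∀ v ∈ ({a, a', b, b'} : Set M),
    IsMonsterAxis R v ∧ IsPrimitiveAxis R v ∧ form v v = 1
  left : ∀ v ∈ ({a, a'} : Set M), ∃ τ : M ≃ₗ[R] M,
    IsMiyamotoInvolution R v τ ∧ τ b = b' ∧ τ b' = b
  right : ∀ v ∈ ({b, b'} : Set M), ∃ τ : M ≃ₗ[R] M,
    IsMiyamotoInvolution R v τ ∧ τ a = a' ∧ τ a' = a

namespace IsMiyamotoQuad

variable {form : LinearMap.BilinForm R M}

theorem symm {a a' b b' : M} (h : IsMiyamotoQuad form a a' b b') :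
    IsMiyamotoQuad form b b' a a' where
  axis v hv := h.axis v (by simp at hv ⊢; tauto)
  left := h.right
  right := h.left

theorem flip {a a' b b' : M} (h : IsMiyamotoQuad form a a' b b') :
    IsMiyamotoQuad form a' a b b' where
  axis v hv := h.axis v (by simp at hv ⊢; tauto)
  left v hv := h.left v (by simp at hv ⊢; tauto)
  right v hv := by
    obtain ⟨τ, h1, h2, h3⟩ := h.right v hv
    exact ⟨τ, h1, h3, h2⟩

theorem flip_right {a a' b b' : M} (h : IsMiyamotoQuad form a a' b b') :
    IsMiyamotoQuad form a a' b' b :=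
  h.symm.flip.symm

theorem mul_comm_eq {a b s : M} (hs : (32 : R) • (a * b) = (32 : R) • s + a + b) :
    (32 : R) • (b * a) = (32 : R) • s + b + a := by
  rw [mul_comm, hs]; module

variable (hform : ∀ u v w : M, form u (v * w) = form (u * v) w)

include hform

/-- Here `b - b'` is twice the `1/32`-component of `b`. This is why `s` does not depend on the
choice of `b` or `b'`. -/
theorem mul_sub_right {a a' b b' : M} (h : IsMiyamotoQuad form a a' b b') :
    (32 : R) • (a * b) - (32 : R) • (a * b') = b - b' ∧ form a b = form a b' := by
  obtain ⟨ha, hp, haa⟩ := h.axis a (by simp)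
  obtain ⟨hb, -, hbb⟩ := h.axis b (by simp)
  obtain ⟨τ, hτ, hτb, -⟩ := h.left a (by simp)
  obtain ⟨h1, h2, -⟩ := fusion_of_axis_pair hform ha hp haa hτ hτb hb.idem hbb rfl rfl rfl rfl
  exact ⟨h1, by simpa [sub_eq_zero] using h2⟩

theorem mul_eq {a a' b b' s : M} (h : IsMiyamotoQuad form a a' b b')
    (hs : (32 : R) • (a * b) = (32 : R) • s + a + b) :
    (32 : R) • (a * b') = (32 : R) • s + a + b' := by
  have := (h.mul_sub_right hform).1
  linear_combination (norm := module) hs - this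

theorem form_comm {a a' b b' : M} (h : IsMiyamotoQuad form a a' b b') (v : M) :
    form a v = form v a :=
  form_axis_comm hform (h.axis a (by simp)).1 (h.axis a (by simp)).2.1 v

/-- The `1/4`-component of `b` is a multiple of `64 s + (2 - 64 L) a + b + b'`; its eigenvector
equation can be solved for `a * s`. -/
theorem mul_s {a a' b b' s : M} (h : IsMiyamotoQuad form a a' b b')
    (hs : (32 : R) • (a * b) = (32 : R) • s + a + b) :
    (2048 : R) • (a * s) = (448 : R) • s + (1536 * form a b - 50) • a + (7 : R) • (b + b') := by
  obtain ⟨ha, hp, haa⟩ := h.axis a (by simp)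
  obtain ⟨hb, -, hbb⟩ := h.axis b (by simp)
  obtain ⟨τ, hτ, hτb, -⟩ := h.left a (by simp)
  have hs' := h.mul_eq hform hs
  obtain ⟨-, -, hQ, -⟩ := fusion_of_axis_pair hform ha hp haa hτ hτb hb.idem hbb rfl rfl rfl rfl
  set L := form a b
  have hQ' : (64 : R) • (a * b) - (64 * L) • a - (b - b') =
      (64 : R) • s + (2 - 64 * L) • a + (b + b') := by
    linear_combination (norm := module) (2 : R) • hs
  rw [hQ'] at hQ
  simp only [mul_add, mul_smul_comm, ha.idem] at hQ
  linear_combination (norm := module) (8 : R) • hQ - hs - hs'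

theorem resurrection {a a' b b' s : M} (h : IsMiyamotoQuad form a a' b b')
    (hs : (32 : R) • (a * b) = (32 : R) • s + a + b) {L m : R} (hL : form a b = L)
    (hm : form b b' = m) :
    (192 : R) • (a * (b * b')) = (2048 * L - 64) • s +
      (-2048 * L ^ 2 + 320 * L - 8 * m - 8) • a + (32 * L - 1) • (b + b') +
      (14 : R) • (a * a') ∧
    (98304 : R) • (s * s) = (-40960 * L - 832) • s +
      (114688 * L ^ 2 - 1792 * L + 448 * m - 56) • a + (63 : R) • (a + a') +
      (6272 * L - 133) • (b + b') + (336 : R) • (b * b') - (448 : R) • (a * a') := by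
  obtain ⟨ha, hp, haa⟩ := h.axis a (by simp)
  obtain ⟨hb, -, hbb⟩ := h.axis b (by simp)
  obtain ⟨hb', -, -⟩ := h.axis b' (by simp)
  obtain ⟨τ, hτ, hτb, -⟩ := h.left a (by simp)
  have hs' := h.mul_eq hform hs
  have hm' : form b' b = m := by rw [← hm, h.symm.form_comm hform]
  obtain ⟨-, -, -, -, h1, h2, h3⟩ :=
    fusion_of_axis_pair hform ha hp haa hτ hτb hb.idem hbb hL hm' rfl rfl
  have hbL : form b a = L := by rw [← hL, h.form_comm hform]
  have hbL' : form b' a = L := by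
    rw [← hL, (h.mul_sub_right hform).2, h.form_comm hform]
  have as := h.mul_s hform hs
  have bs := h.symm.mul_s hform (mul_comm_eq hs)
  have bs' := h.flip_right.symm.mul_s hform (mul_comm_eq hs')
  rw [hL] at as
  rw [hbL] at bs
  rw [hbL'] at bs'
  refine fusion_resurrection ha.idem ?_ ?_ ?_ as ?_ ?_ ?_ h1 h2 h3
  · rw [mul_add]
    linear_combination (norm := module) hs + hs'
  · simp only [mul_add, add_mul, hb.idem, hb'.idem, mul_comm b' b]
    module
  · rw [mul_add, mul_comm s b, mul_comm s b']
    linear_combination (norm := module) bs + bs'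
  · rw [mul_add, ha.idem]
  · linear_combination (norm := module) (2 : R) • hs
  · module

/-- The resurrection formulas for `s * s` determine the form. -/
theorem form_eq {a a' b b' s : M} [IsDomain R] (h : IsMiyamotoQuad form a a' b b') (hne : b ≠ b')
    (hs : (32 : R) • (a * b) = (32 : R) • s + a + b) (hK : 8 * form a a' = 1) :
    64 * form a b = 1 ∧ 8 * form b b' = 1 ∧
      (8 : R) • (b * b') = (8 : R) • (a * a') + b + b' - a - a' := by
  obtain ⟨L, hL⟩ : ∃ L, form a b = L := ⟨_, rfl⟩
  obtain ⟨m, hm⟩ : ∃ m, form b b' = m := ⟨_, rfl⟩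
  obtain ⟨-, -, haa⟩ := h.axis a (by simp)
  obtain ⟨-, -, hbb⟩ := h.axis b (by simp)
  have hbL : form b a = L := by rw [← hL, h.form_comm hform]
  have hbL' : form b' a = L := by
    rw [← hL, (h.mul_sub_right hform).2, h.form_comm hform]
  have haL : form a' b = L := by
    rw [h.flip.form_comm hform, ← (h.symm.mul_sub_right hform).2, hbL]
  have hs' := h.mul_eq hform hs
  have hsa' := mul_comm_eq (h.symm.mul_eq hform (mul_comm_eq hs))
  have hK' : 8 * form a' a = 1 := by rw [h.flip.form_comm hform, hK]
  have r1 := (h.resurrection hform hs hL hm).2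
  have r2 := (h.flip.resurrection hform hsa' haL hm).2
  have r3 := (h.symm.resurrection hform (mul_comm_eq hs) hbL rfl).2
  have r4 := (h.flip_right.symm.resurrection hform (mul_comm_eq hs') hbL' rfl).2
  rw [mul_comm a' a] at r2
  rw [mul_comm b' b] at r4
  have cancel : ∀ {n : ℕ} {x : R}, n ≠ 0 → (n : R) * x = 0 → x = 0 := fun hn hx =>
    mul_cancel_of_real hn (by rw [hx, mul_zero])
  -- Up to this one multiple of `a`, the formula for `s * s` is symmetric in `a` and `a'`. Pairing
  -- with `a` makes the coefficient vanish, as `⟨a, a - a'⟩ = 7/8`; for `b - b'` the factor is `1 -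
  -- m`, not yet known to be nonzero.
  have d1 : (114688 * L ^ 2 - 1792 * L + 448 * m - 56) • (a - a') = 0 := by
    linear_combination (norm := module) r2 - r1
  have d2 : (114688 * L ^ 2 - 1792 * L + 448 * form a a' - 56) • (b - b') = 0 := by
    linear_combination (norm := module) r4 - r3
  have p1 : 2048 * L ^ 2 - 32 * L + 8 * m - 1 = 0 := by
    have := congrArg (form a) d1
    simp only [map_smul, map_sub, map_zero, haa, smul_eq_mul] at this
    apply cancel (n := 392) (by norm_num)
    push_cast
    linear_combination 8 * this + (114688 * L ^ 2 - 1792 * L + 448 * m - 56) * hK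
  have d3 : (1792 * (L * (64 * L - 1))) • (b - b') = 0 := by
    rw [← d2]; congr 1; linear_combination -56 * hK
  have p2 : (L * (64 * L - 1)) * (1 - m) = 0 := by
    have := congrArg (form b) d3
    simp only [map_smul, map_sub, map_zero, hbb, hm, smul_eq_mul] at this
    apply cancel (n := 1792) (by norm_num)
    push_cast
    linear_combination this
  have p3 : L * (64 * L - 1) = 0 := by
    rcases mul_eq_zero.1 p2 with h0 | h0
    · exact h0
    -- If `m = 1`, then `p1` turns the coefficient in `d3` into the constant `-392`, so `b = b'`.
    · exfalso
      apply hne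
      rw [← sub_eq_zero]
      apply smul_cancel_of_real R (n := 392) (by norm_num)
      rw [smul_zero, ← neg_eq_zero, ← d3, ← neg_smul]
      congr 1
      push_cast
      linear_combination -56 * p1 - 448 * h0
  have p4 : 8 * m = 1 := by linear_combination p1 - 32 * p3
  -- Equate the formulas for `s * s` seen from `a` and from `b`; the terms removed by `q1`, `q2`
  -- have coefficient zero.
  have ht : (4 : R) • (b * b') = (4 : R) • (a * a') + (32 * L - 1) • (a + a' - b - b') := by
    have q1 : (114688 * L ^ 2 - 1792 * L + 448 * m - 56) • a = 0 := by
      have : 114688 * L ^ 2 - 1792 * L + 448 * m - 56 = 0 := by linear_combination 56 * p1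
      rw [this, zero_smul]
    have q2 : (114688 * L ^ 2 - 1792 * L + 448 * form a a' - 56) • b = 0 := by
      have : 114688 * L ^ 2 - 1792 * L + 448 * form a a' - 56 = 0 := by
        linear_combination 1792 * p3 + 56 * hK
      rw [this, zero_smul]
    apply smul_cancel_of_real R (n := 196) (by norm_num)
    push_cast
    linear_combination (norm := module) r3 - r1 - q1 + q2
  -- For `L = 0`, computing `⟨a, b * b'⟩ = ⟨a * b, b'⟩` from `mul_sub_right` gives `-7/256`, whereas
  -- `ht` gives `-5/32`.
  have hLne : L ≠ 0 := by
    intro h0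
    have hd := congrArg (fun v => form v b') (h.mul_sub_right hform).1
    have hab' : form (a * b') b' = L := by
      rw [← hform, (h.axis b' (by simp)).1.idem, ← (h.mul_sub_right hform).2, hL]
    have hbb' : form b' b' = 1 := (h.axis b' (by simp)).2.2
    simp only [map_sub, map_smul, LinearMap.sub_apply, LinearMap.smul_apply, smul_eq_mul, hab',
      hbb', hm] at hd
    have h4 := congrArg (form a) ht
    have haa' : form a (a * a') = form a a' := by rw [hform, (h.axis a (by simp)).1.idem]
    simp only [map_sub, map_add, map_smul, smul_eq_mul, haa, haa', hL,
      ← (h.mul_sub_right hform).2] at h4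
    rw [hform] at h4
    have : (1 : R) = 0 := by
      apply cancel (n := 33) (by norm_num)
      push_cast
      linear_combination -8 * hd + 64 * h4 - p4 + 24 * hK +
        (2048 * (1 + form a a' - 2 * L) - 128) * h0
    exact one_ne_zero this
  have p5 : 64 * L = 1 := by
    rcases mul_eq_zero.1 p3 with h0 | h0
    · exact absurd h0 hLne
    · linear_combination h0
  refine ⟨by rw [hL, p5], by rw [hm, p4], ?_⟩
  have : (64 * L) • (a + a' - b - b') = (1 : R) • (a + a' - b - b') := by rw [p5]
  linear_combination (norm := module) (2 : R) • ht + this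

/-- If `a` and `a'` generate an algebra of type `2A`, then `a` and `b` generate one of
type `4B`. -/
theorem dihedral4B {a a' b b' c : M} [IsDomain R] (h : IsMiyamotoQuad form a a' b b')
    (hne : b ≠ b') (hK : 8 * form a a' = 1) (hc : (8 : R) • (a * a') = a + a' - c)
    (hac : (8 : R) • (a * c) = a + c - a') :
    64 * form a b = 1 ∧ 8 * form b b' = 1 ∧ (8 : R) • (b * b') = b + b' - c ∧
      (64 : R) • (a * b) = a + b - a' - b' + c ∧ (8 : R) • (b * c) = b + c - b' := by
  obtain ⟨s, hs⟩ : ∃ s : M, (32 : R) • (a * b) = (32 : R) • s + a + b := by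
    refine ⟨a * b - algebraMap ℝ R (1 / (32 : ℕ)) • (a + b), ?_⟩
    have := nsmul_algebraMap_inv (R := R) (n := 32) (by norm_num) (a + b)
    rw [smul_sub, ← Nat.cast_ofNat (R := R), this]
    module
  obtain ⟨hL, hm, ht⟩ := h.form_eq hform hne hs hK
  have hs' := h.mul_eq hform hs
  have hsa' := h.symm.mul_eq hform (mul_comm_eq hs)
  have hbL : 64 * form b a = 1 := by rw [← hL, h.form_comm hform]
  have r1 := (h.resurrection hform hs rfl rfl).1
  have r2 := (h.symm.resurrection hform (mul_comm_eq hs) rfl rfl).1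
  have coeff : ∀ L K : R, 64 * L = 1 → 8 * K = 1 → ∀ x y z : M,
      (2 : R) • ((2048 * L - 64) • x + (-2048 * L ^ 2 + 320 * L - 8 * K - 8) • y +
        (32 * L - 1) • z) = (-64 : R) • x - (9 : R) • y - z := by
    intro L K hL hK x y z
    match_scalars
    · linear_combination 64 * hL
    · linear_combination (-64 * L + 9) * hL - 2 * hK
    · linear_combination hL
  have k1 := coeff _ _ hL hm s a (b + b')
  have k2 := coeff _ _ hbL hK s b (a + a')
  have ht' : (8 : R) • (b * b') = b + b' - c := by
    linear_combination (norm := module) ht + hc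
  have hat := congrArg (a * ·) ht'
  have hbx := congrArg (b * ·) hc
  simp only [mul_add, mul_sub, mul_smul_comm] at hat hbx
  -- `a * (b * b')` is known twice: from resurrection, and from `8 (b * b') = b + b' - c` with `a *
  -- c` given. Equating them determines `s`; the same comparison for `b * (a * a')` then yields `b *
  -- c`.
  have hs64 : (64 : R) • s = c - a - a' - b - b' := by
    apply smul_cancel_of_real R (n := 5) (by norm_num)
    push_cast
    linear_combination (norm := module) (4 : R) • r1 + (2 : R) • k1 - (96 : R) • hat -
      (3 : R) • hs - (3 : R) • hs' + (12 : R) • hac + (7 : R) • hc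
  refine ⟨hL, hm, ht', ?_, ?_⟩
  · linear_combination (norm := module) (2 : R) • hs + hs64
  · apply smul_cancel_of_real R (n := 24) (by norm_num)
    push_cast
    linear_combination (norm := module) (-8 : R) • r2 - (4 : R) • k2 + (192 : R) • hbx +
      (6 : R) • mul_comm_eq hs + (6 : R) • hsa' + (10 : R) • hs64 - (14 : R) • ht'

end IsMiyamotoQuad

end Quad

/-! ### The multiplication table forced by the shape. -/

section Table

/-- The products and values of the form of the algebras of shape `4B`; the vector `c` spans the
intersection of the subalgebras generated by `a_i` and `a_{-i}`. -/
structure HasTable4B (𝓑 : MarkedFrobeniusAlgebra.{v} AxisIndex) (c : 𝓑.M) : Prop where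
  idem : ∀ i, 𝓑.gen i * 𝓑.gen i = 𝓑.gen i
  idem_c : c * c = c
  form_self : ∀ i, 𝓑.form (𝓑.gen i) (𝓑.gen i) = 1
  form_c : 𝓑.form c c = 1
  mul_neg : ∀ i e, (8 : 𝓑.R) • (𝓑.gen (i, e) * 𝓑.gen (i, -e)) =
    𝓑.gen (i, e) + 𝓑.gen (i, -e) - c
  form_neg : ∀ i e, 8 * 𝓑.form (𝓑.gen (i, e)) (𝓑.gen (i, -e)) = 1
  mul_c : ∀ i e, (8 : 𝓑.R) • (𝓑.gen (i, e) * c) = 𝓑.gen (i, e) + c - 𝓑.gen (i, -e)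
  form_gen_c : ∀ i e, 8 * 𝓑.form (𝓑.gen (i, e)) c = 1 ∧ 8 * 𝓑.form c (𝓑.gen (i, e)) = 1
  mul_ne : ∀ i j e d, i ≠ j → (64 : 𝓑.R) • (𝓑.gen (i, e) * 𝓑.gen (j, d)) =
    𝓑.gen (i, e) + 𝓑.gen (j, d) - 𝓑.gen (i, -e) - 𝓑.gen (j, -d) + c
  form_ne : ∀ i j e d, i ≠ j → 64 * 𝓑.form (𝓑.gen (i, e)) (𝓑.gen (j, d)) = 1

theorem IsShape4B.isMiyamotoQuad {𝓑 : MarkedFrobeniusAlgebra.{v} AxisIndex} (h : IsShape4B 𝓑)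
    {i j : Fin 3} (hij : i ≠ j) (e d : ℤˣ) :
    IsMiyamotoQuad 𝓑.form (𝓑.gen (i, e)) (𝓑.gen (i, -e)) (𝓑.gen (j, d)) (𝓑.gen (j, -d)) := by
  have key : ∀ {i j : Fin 3}, i ≠ j → ∀ e d : ℤˣ, ∃ τ : 𝓑.M ≃ₗ[𝓑.R] 𝓑.M,
      IsMiyamotoInvolution 𝓑.R (𝓑.gen (i, e)) τ ∧ τ (𝓑.gen (j, d)) = 𝓑.gen (j, -d) ∧
      τ (𝓑.gen (j, -d)) = 𝓑.gen (j, d) := by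
    intro i j hij e d
    obtain ⟨τ, hτ, hg⟩ := h.miyamoto (i, e)
    exact ⟨τ, hτ, by simp [hg, axisPerm, hij.symm], by simp [hg, axisPerm, hij.symm]⟩
  refine ⟨?_, ?_, ?_⟩
  · rintro v (rfl | rfl | rfl | rfl) <;> exact ⟨h.axis _, h.primitive _, h.form_axis _⟩
  · rintro v (rfl | rfl) <;> exact key hij _ _
  · rintro v (rfl | rfl) <;> exact key hij.symm _ _

/-- The `2A` relations of `a_{±1}` and the normalisation of `c` are all that is taken from the
shape. `dihedral4B` carries them to every other pair with the same `c`, and is then applied between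
any two pairs. -/
theorem IsShape4B.exists_table {𝓑 : MarkedFrobeniusAlgebra.{v} AxisIndex} (h : IsShape4B 𝓑) :
    ∃ c, HasTable4B 𝓑 c := by
  obtain ⟨c, -, -, ⟨-, -, -, -, hcc⟩, -, ⟨h1, -, h3, h4, -, -⟩, ⟨-, -, -, -, f1⟩, -,
    ⟨f2, -⟩⟩ := h.shape
  have f2' : 8 * 𝓑.form (𝓑.gen (0, 1)) (𝓑.gen (0, -1)) = 1 := by
    rw [f2, ← map_ofNat (algebraMap ℝ 𝓑.R) 8, ← map_mul]; norm_num
  have hne : ∀ (j : Fin 3) (d : ℤˣ), 𝓑.gen (j, d) ≠ 𝓑.gen (j, -d) := by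
    intro j d hd
    have := h.gen_injective hd
    rcases Int.units_eq_one_or d with rfl | rfl <;> simp at this
  have comm := fun i => form_axis_comm 𝓑.form_assoc (h.axis i) (h.primitive i)
  have p0 : ∀ e : ℤˣ, 8 * 𝓑.form (𝓑.gen (0, e)) (𝓑.gen (0, -e)) = 1 ∧
      (8 : 𝓑.R) • (𝓑.gen (0, e) * 𝓑.gen (0, -e)) = 𝓑.gen (0, e) + 𝓑.gen (0, -e) - c ∧
      (8 : 𝓑.R) • (𝓑.gen (0, e) * c) = 𝓑.gen (0, e) + c - 𝓑.gen (0, -e) := by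
    intro e
    rcases Int.units_eq_one_or e with rfl | rfl
    · exact ⟨f2', h1, h3⟩
    · rw [neg_neg, ← comm]
      exact ⟨f2', by rw [mul_comm, h1, add_comm], h4⟩
  have step : ∀ {i j : Fin 3} (e d : ℤˣ), i ≠ j → _ := fun {i j} e d hij =>
    (h.isMiyamotoQuad hij e d).dihedral4B 𝓑.form_assoc (c := c) (hne j d)
  have pj : ∀ (j : Fin 3) (e : ℤˣ), 8 * 𝓑.form (𝓑.gen (j, e)) (𝓑.gen (j, -e)) = 1 ∧
      (8 : 𝓑.R) • (𝓑.gen (j, e) * 𝓑.gen (j, -e)) = 𝓑.gen (j, e) + 𝓑.gen (j, -e) - c ∧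
      (8 : 𝓑.R) • (𝓑.gen (j, e) * c) = 𝓑.gen (j, e) + c - 𝓑.gen (j, -e) := by
    intro j e
    by_cases hj : 0 = j
    · subst hj; exact p0 e
    · obtain ⟨-, r1, r2, -, r3⟩ := step 1 e hj (p0 1).1 (p0 1).2.1 (p0 1).2.2
      exact ⟨r1, r2, r3⟩
  have hgc : ∀ i e, 8 * 𝓑.form (𝓑.gen (i, e)) c = 1 := by
    intro i e
    have hc : c = 𝓑.gen (i, e) + 𝓑.gen (i, -e) - (8 : 𝓑.R) • (𝓑.gen (i, e) * 𝓑.gen (i, -e)) := by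
      rw [(pj i e).2.1]; abel
    rw [hc, map_sub, map_add, map_smul, 𝓑.form_assoc, (h.axis _).idem, h.form_axis, smul_eq_mul]
    linear_combination -7 * (pj i e).1
  exact ⟨c,
    { idem := fun i => (h.axis i).idem
      idem_c := hcc
      form_self := h.form_axis
      form_c := f1
      mul_neg := fun i e => (pj i e).2.1
      form_neg := fun i e => (pj i e).1
      mul_c := fun i e => (pj i e).2.2
      form_gen_c := fun i e => ⟨hgc i e, by rw [← comm, hgc]⟩
      mul_ne := fun i j e d hij => by
        rw [(step e d hij (pj i e).1 (pj i e).2.1 (pj i e).2.2).2.2.2.1]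
      form_ne := fun i j e d hij => (step e d hij (pj i e).1 (pj i e).2.1 (pj i e).2.2).1 }⟩

end Table

/-! ### The model: product and form. -/

/-- The underlying space of the universal algebra of shape `4B`. A vector has coordinates `φ_i`,
`δ_i` and `γ` with respect to the idempotents `f_i = (4 (a_i + a_{-i}) - a_ρ) / 5`, the differences
`a_i - a_{-i}` and the vector `a_ρ`. -/
def Model4B : Type := (Fin 3 → ℝ) × (Fin 3 → ℝ) × ℝ

namespace Model4B

noncomputable instance : AddCommGroup Model4B :=
  inferInstanceAs (AddCommGroup ((Fin 3 → ℝ) × (Fin 3 → ℝ) × ℝ))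

noncomputable instance : Module ℝ Model4B :=
  inferInstanceAs (Module ℝ ((Fin 3 → ℝ) × (Fin 3 → ℝ) × ℝ))

/-- The coordinate of `f_i`. -/
noncomputable def φ (i : Fin 3) : Model4B →ₗ[ℝ] ℝ where
  toFun x := x.1 i
  map_add' _ _ := rfl
  map_smul' _ _ := rfl

/-- The coordinate of `a_i - a_{-i}`. -/
noncomputable def δ (i : Fin 3) : Model4B →ₗ[ℝ] ℝ where
  toFun x := x.2.1 i
  map_add' _ _ := rfl
  map_smul' _ _ := rfl

/-- The coordinate of `a_ρ`. -/
noncomputable def γ : Model4B →ₗ[ℝ] ℝ where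
  toFun x := x.2.2
  map_add' _ _ := rfl
  map_smul' _ _ := rfl

/-- The vector with given coordinates. -/
def mk (p d : Fin 3 → ℝ) (g : ℝ) : Model4B := (p, d, g)

@[simp] theorem φ_mk (p d : Fin 3 → ℝ) (g : ℝ) (i : Fin 3) : φ i (mk p d g) = p i := rfl
@[simp] theorem δ_mk (p d : Fin 3 → ℝ) (g : ℝ) (i : Fin 3) : δ i (mk p d g) = d i := rfl
@[simp] theorem γ_mk (p d : Fin 3 → ℝ) (g : ℝ) : γ (mk p d g) = g := rfl

theorem ext' {x y : Model4B} (h1 : ∀ i, φ i x = φ i y) (h2 : ∀ i, δ i x = δ i y)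
    (h3 : γ x = γ y) : x = y :=
  Prod.ext (funext h1) (Prod.ext (funext h2) h3)

/-- The `f_i` and `a_ρ` are orthogonal idempotents; `d_i` has eigenvalue `3/4` under `f_i` and `1/4`
under `a_ρ`; `d_i * d_i = 15/16 f_i + 7/16 a_ρ`; all other products of these vectors vanish. -/
noncomputable instance : Mul Model4B where
  mul x y := mk (fun i => φ i x * φ i y + 15 / 16 * (δ i x * δ i y))
    (fun i => 3 / 4 * (φ i x * δ i y + δ i x * φ i y) + 1 / 4 * (γ x * δ i y + δ i x * γ y))
    (γ x * γ y + 7 / 16 * ∑ i, δ i x * δ i y)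

@[simp] theorem φ_mul (i : Fin 3) (x y : Model4B) :
    φ i (x * y) = φ i x * φ i y + 15 / 16 * (δ i x * δ i y) := rfl
@[simp] theorem δ_mul (i : Fin 3) (x y : Model4B) : δ i (x * y) =
    3 / 4 * (φ i x * δ i y + δ i x * φ i y) + 1 / 4 * (γ x * δ i y + δ i x * γ y) := rfl
@[simp] theorem γ_mul (x y : Model4B) :
    γ (x * y) = γ x * γ y + 7 / 16 * ∑ i, δ i x * δ i y := rfl

noncomputable instance : NonUnitalNonAssocCommRing Model4B where
  left_distrib x y z := by
    apply ext'
    · intro i; simp; ring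
    · intro i; simp; ring
    · simp [Fin.sum_univ_three]; ring
  right_distrib x y z := by
    apply ext'
    · intro i; simp; ring
    · intro i; simp; ring
    · simp [Fin.sum_univ_three]; ring
  zero_mul x := by apply ext' <;> simp
  mul_zero x := by apply ext' <;> simp
  mul_comm x y := by
    apply ext'
    · intro i; simp; ring
    · intro i; simp; ring
    · simp [Fin.sum_univ_three]; ring

noncomputable instance : SMulCommClass ℝ Model4B Model4B where
  smul_comm r x y := by
    apply ext'
    · intro i; simp; ring
    · intro i; simp; ring
    · simp [Fin.sum_univ_three]; ring

noncomputable instance : IsScalarTower ℝ Model4B Model4B where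
  smul_assoc r x y := by
    apply ext'
    · intro i; simp; ring
    · intro i; simp; ring
    · simp [Fin.sum_univ_three]; ring

/-- The associating form. -/
noncomputable def form : LinearMap.BilinForm ℝ Model4B :=
  LinearMap.mk₂ ℝ (fun x y => ∑ i, (7 / 5 * (φ i x * φ i y) + 7 / 4 * (δ i x * δ i y)) + γ x * γ y)
    (fun x y z => by simp [Fin.sum_univ_three]; ring)
    (fun r x y => by simp [Fin.sum_univ_three]; ring)
    (fun x y z => by simp [Fin.sum_univ_three]; ring)
    (fun r x y => by simp [Fin.sum_univ_three]; ring)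

theorem form_apply (x y : Model4B) : form x y =
    ∑ i, (7 / 5 * (φ i x * φ i y) + 7 / 4 * (δ i x * δ i y)) + γ x * γ y := rfl

theorem form_assoc (x y z : Model4B) : form x (y * z) = form (x * y) z := by
  simp [form_apply, Fin.sum_univ_three]; ring

/-- The form is diagonal with positive entries. This makes every form-preserving map out of the
model injective. -/
theorem form_self_eq_zero {x : Model4B} (h : form x x = 0) : x = 0 := by
  rw [form_apply] at h
  have h1 : ∀ i, 0 ≤ 7 / 5 * (φ i x * φ i x) + 7 / 4 * (δ i x * δ i x) := fun i => by
    nlinarith [mul_self_nonneg (φ i x), mul_self_nonneg (δ i x)]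
  have h2 : ∑ i, (7 / 5 * (φ i x * φ i x) + 7 / 4 * (δ i x * δ i x)) = 0 := by
    nlinarith [mul_self_nonneg (γ x), Finset.sum_nonneg fun i (_ : i ∈ Finset.univ) => h1 i]
  have h3 := (Finset.sum_eq_zero_iff_of_nonneg fun i _ => h1 i).1 h2
  apply ext'
  · intro i
    have := h3 i (Finset.mem_univ i)
    rw [map_zero]
    nlinarith [mul_self_nonneg (φ i x), mul_self_nonneg (δ i x)]
  · intro i
    have := h3 i (Finset.mem_univ i)
    rw [map_zero]
    nlinarith [mul_self_nonneg (φ i x), mul_self_nonneg (δ i x)]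
  · rw [h2] at h
    rw [map_zero]
    nlinarith

/-- The axes `a_{±i}`. -/
noncomputable def axis (p : AxisIndex) : Model4B :=
  mk (Pi.single p.1 (5 / 8)) (Pi.single p.1 (((p.2 : ℤ) : ℝ) / 2)) (1 / 8)

/-- The vector `a_ρ`. -/
noncomputable def rho : Model4B := mk 0 0 1

end Model4B

/-! ### Eigenspaces and fusion rule of the axes of the model. -/

namespace Model4B

variable {i : Fin 3} {e : ℤˣ}

theorem sq_sign (e : ℤˣ) : ((e : ℤ) : ℝ) * ((e : ℤ) : ℝ) = 1 := by
  rcases Int.units_eq_one_or e with rfl | rfl <;> simp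

theorem sum_single_mul (i : Fin 3) (a : ℝ) (f : Fin 3 → ℝ) :
    ∑ j, (Pi.single i a : Fin 3 → ℝ) j * f j = a * f i := by
  simp [Pi.single_apply]

theorem φ_axis_self : φ i (axis (i, e)) = 5 / 8 := by simp [axis]
theorem δ_axis_self : δ i (axis (i, e)) = ((e : ℤ) : ℝ) / 2 := by simp [axis]
theorem φ_axis_of_ne {j : Fin 3} (h : j ≠ i) : φ j (axis (i, e)) = 0 := by simp [axis, h]
theorem δ_axis_of_ne {j : Fin 3} (h : j ≠ i) : δ j (axis (i, e)) = 0 := by simp [axis, h]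
theorem γ_axis : γ (axis (i, e)) = 1 / 8 := by simp [axis]

theorem γ_axis_mul (x : Model4B) :
    γ (axis (i, e) * x) = 1 / 8 * γ x + 7 / 32 * (((e : ℤ) : ℝ) * δ i x) := by
  rw [γ_mul, γ_axis]
  simp only [axis, δ_mk, sum_single_mul]
  ring

/-- A vector is an eigenvector of an axis exactly if it satisfies these coordinate equations. -/
theorem axis_mul_eq_smul_iff (r : ℝ) (x : Model4B) : axis (i, e) * x = r • x ↔
    5 / 8 * φ i x + 15 / 32 * (((e : ℤ) : ℝ) * δ i x) = r * φ i x ∧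
    1 / 2 * δ i x + 3 / 8 * (((e : ℤ) : ℝ) * φ i x) + 1 / 8 * (((e : ℤ) : ℝ) * γ x) = r * δ i x ∧
    1 / 8 * γ x + 7 / 32 * (((e : ℤ) : ℝ) * δ i x) = r * γ x ∧
    ∀ j, j ≠ i → 0 = r * φ j x ∧ 1 / 32 * δ j x = r * δ j x := by
  constructor
  · intro h
    refine ⟨?_, ?_, ?_, fun j hj => ⟨?_, ?_⟩⟩
    · have := congrArg (φ i) h
      rw [φ_mul, φ_axis_self, δ_axis_self, map_smul, smul_eq_mul] at this
      linear_combination this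
    · have := congrArg (δ i) h
      rw [δ_mul, φ_axis_self, δ_axis_self, γ_axis, map_smul, smul_eq_mul] at this
      linear_combination this
    · have := congrArg γ h
      rwa [γ_axis_mul, map_smul, smul_eq_mul] at this
    · have := congrArg (φ j) h
      rw [φ_mul, φ_axis_of_ne hj, δ_axis_of_ne hj, map_smul, smul_eq_mul] at this
      linear_combination this
    · have := congrArg (δ j) h
      rw [δ_mul, φ_axis_of_ne hj, δ_axis_of_ne hj, γ_axis, map_smul, smul_eq_mul] at this
      linear_combination this
  · rintro ⟨h1, h2, h3, h4⟩
    apply ext'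
    · intro j
      by_cases hj : j = i
      · subst hj
        rw [φ_mul, φ_axis_self, δ_axis_self, map_smul, smul_eq_mul]
        linear_combination h1
      · rw [φ_mul, φ_axis_of_ne hj, δ_axis_of_ne hj, map_smul, smul_eq_mul]
        linear_combination (h4 j hj).1
    · intro j
      by_cases hj : j = i
      · subst hj
        rw [δ_mul, φ_axis_self, δ_axis_self, γ_axis, map_smul, smul_eq_mul]
        linear_combination h2
      · rw [δ_mul, φ_axis_of_ne hj, δ_axis_of_ne hj, γ_axis, map_smul, smul_eq_mul]
        linear_combination (h4 j hj).2
    · rw [γ_axis_mul, map_smul, smul_eq_mul, h3]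

theorem mem_one {x : Model4B} : x ∈ adEigenspace ℝ (axis (i, e)) .one ↔
    φ i x = 5 / 4 * (((e : ℤ) : ℝ) * δ i x) ∧ γ x = 1 / 4 * (((e : ℤ) : ℝ) * δ i x) ∧
      ∀ j, j ≠ i → φ j x = 0 ∧ δ j x = 0 := by
  have he := sq_sign e
  rw [mem_adEigenspace_iff, Algebra.algebraMap_self, RingHom.id_apply, axis_mul_eq_smul_iff,
    MonsterLabel.val]
  constructor
  · rintro ⟨h1, h2, h3, h4⟩
    exact ⟨by linarith, by linarith, fun j hj => ⟨by linarith [(h4 j hj).1],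
      by linarith [(h4 j hj).2]⟩⟩
  · rintro ⟨h1, h2, h3⟩
    refine ⟨by linarith, ?_, by linarith, fun j hj => by simp [h3 j hj]⟩
    rw [h1, h2]; linear_combination (1 / 2 * δ i x) * he

theorem mem_zero {x : Model4B} : x ∈ adEigenspace ℝ (axis (i, e)) .zero ↔
    φ i x = -3 / 4 * (((e : ℤ) : ℝ) * δ i x) ∧ γ x = -7 / 4 * (((e : ℤ) : ℝ) * δ i x) ∧
      ∀ j, j ≠ i → δ j x = 0 := by
  have he := sq_sign e
  rw [mem_adEigenspace_iff, Algebra.algebraMap_self, RingHom.id_apply, axis_mul_eq_smul_iff,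
    MonsterLabel.val]
  constructor
  · rintro ⟨h1, h2, h3, h4⟩
    exact ⟨by linarith, by linarith, fun j hj => by linarith [(h4 j hj).2]⟩
  · rintro ⟨h1, h2, h3⟩
    refine ⟨by linarith, ?_, by linarith, fun j hj => by simp [h3 j hj]⟩
    rw [h1, h2]; linear_combination (-1 / 2 * δ i x) * he

theorem mem_quarter {x : Model4B} : x ∈ adEigenspace ℝ (axis (i, e)) .quarter ↔
    φ i x = -5 / 4 * (((e : ℤ) : ℝ) * δ i x) ∧ γ x = 7 / 4 * (((e : ℤ) : ℝ) * δ i x) ∧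
      ∀ j, j ≠ i → φ j x = 0 ∧ δ j x = 0 := by
  have he := sq_sign e
  rw [mem_adEigenspace_iff, Algebra.algebraMap_self, RingHom.id_apply, axis_mul_eq_smul_iff,
    MonsterLabel.val]
  constructor
  · rintro ⟨h1, h2, h3, h4⟩
    exact ⟨by linarith, by linarith, fun j hj => ⟨by linarith [(h4 j hj).1],
      by linarith [(h4 j hj).2]⟩⟩
  · rintro ⟨h1, h2, h3⟩
    refine ⟨by linarith, ?_, by linarith, fun j hj => by simp [h3 j hj]⟩
    rw [h1, h2]; linear_combination (-1 / 4 * δ i x) * he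

theorem mem_thirtySecond {x : Model4B} : x ∈ adEigenspace ℝ (axis (i, e)) .thirtySecond ↔
    (∀ j, φ j x = 0) ∧ δ i x = 0 ∧ γ x = 0 := by
  have he := sq_sign e
  rw [mem_adEigenspace_iff, Algebra.algebraMap_self, RingHom.id_apply, axis_mul_eq_smul_iff,
    MonsterLabel.val]
  constructor
  · rintro ⟨h1, h2, h3, h4⟩
    -- On the block `f_i, d_i, a_ρ` the axis has eigenvalues `1, 0, 1/4` only; eliminating `φ i x`
    -- and `γ x` leaves `-217/1824 * δ i x = 0`.
    have h5 : δ i x = 0 := by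
      linear_combination (-1824 / 217) * (h2 - 12 / 19 * ((e : ℤ) : ℝ) * h1 -
        4 / 3 * ((e : ℤ) : ℝ) * h3) - 1824 / 217 * (45 / 152 + 7 / 24) * δ i x * he
    refine ⟨fun j => ?_, ?_, ?_⟩
    · by_cases hj : j = i
      · subst hj; rw [h5] at h1; linarith
      · linarith [(h4 j hj).1]
    · exact h5
    · rw [h5] at h3; linarith
  · rintro ⟨h1, h2, h3⟩
    simp [h1, h2, h3]

/-- The coordinate `δ_i` of the component of a vector for the eigenvalue `1 / 4`. -/
noncomputable def quarterCoord (i : Fin 3) (e : ℤˣ) (x : Model4B) : ℝ :=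
  1 / 4 * (δ i x - ((e : ℤ) : ℝ) * φ i x + ((e : ℤ) : ℝ) * γ x)

/-- The coordinate `δ_i` of the component of a vector for the eigenvalue `0`. -/
noncomputable def zeroCoord (i : Fin 3) (e : ℤˣ) (x : Model4B) : ℝ :=
  5 / 16 * δ i x - 3 / 16 * (((e : ℤ) : ℝ) * φ i x) - 5 / 16 * (((e : ℤ) : ℝ) * γ x)

/-- The components of a vector in the eigenspaces of an axis. -/
noncomputable def component (i : Fin 3) (e : ℤˣ) (x : Model4B) : MonsterLabel → Model4B
  | .one => (7 / 8 * φ i x + 7 / 8 * (((e : ℤ) : ℝ) * δ i x) + 1 / 8 * γ x) • axis (i, e)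
  | .zero => mk (fun j => if j = i then -3 / 4 * (((e : ℤ) : ℝ) * zeroCoord i e x) else φ j x)
      (Pi.single i (zeroCoord i e x)) (-7 / 4 * (((e : ℤ) : ℝ) * zeroCoord i e x))
  | .quarter => mk (Pi.single i (-5 / 4 * (((e : ℤ) : ℝ) * quarterCoord i e x)))
      (Pi.single i (quarterCoord i e x)) (7 / 4 * (((e : ℤ) : ℝ) * quarterCoord i e x))
  | .thirtySecond => mk 0 (fun j => if j = i then 0 else δ j x) 0

theorem axis_mem_one : axis (i, e) ∈ adEigenspace ℝ (axis (i, e)) .one := by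
  rw [mem_one, φ_axis_self, δ_axis_self, γ_axis]
  refine ⟨?_, ?_, fun j hj => ⟨φ_axis_of_ne hj, δ_axis_of_ne hj⟩⟩
  · linear_combination -5 / 8 * sq_sign e
  · linear_combination -1 / 8 * sq_sign e

theorem component_mem (x : Model4B) (l : MonsterLabel) :
    component i e x l ∈ adEigenspace ℝ (axis (i, e)) l := by
  cases l
  · exact Submodule.smul_mem _ _ axis_mem_one
  · rw [mem_zero]
    refine ⟨by simp [component], by simp [component], fun j hj => by simp [component, hj]⟩
  · rw [mem_quarter]
    refine ⟨by simp [component], by simp [component], fun j hj => by simp [component, hj]⟩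
  · rw [mem_thirtySecond]
    simp [component]

theorem sum_component (x : Model4B) : component i e x .one + component i e x .zero +
    component i e x .quarter + component i e x .thirtySecond = x := by
  have he := sq_sign e
  apply ext'
  · intro j
    by_cases hj : j = i
    · subst hj
      simp only [map_add, component, map_smul, φ_mk, φ_axis_self, smul_eq_mul, Pi.single_eq_same,
        if_true, Pi.zero_apply, zeroCoord, quarterCoord]
      linear_combination (9 / 64 * φ j x + 5 / 16 * φ j x - 5 / 64 * γ x) * he
    · simp [component, φ_axis_of_ne hj, hj]
  · intro j
    by_cases hj : j = i
    · subst hj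
      simp only [map_add, component, map_smul, δ_mk, δ_axis_self, smul_eq_mul, Pi.single_eq_same,
        if_true, zeroCoord, quarterCoord]
      linear_combination (7 / 16 * δ j x) * he
    · simp [component, δ_axis_of_ne hj, hj]
  · simp only [map_add, component, map_smul, γ_mk, γ_axis, smul_eq_mul, zeroCoord, quarterCoord]
    linear_combination (63 / 64 * γ x - 7 / 64 * φ i x) * he

/-- The explicit `component`s sum to `x`, so membership reduces to the vanishing of the components
outside `s`. -/
theorem mem_adEigenspaces {x : Model4B} {s : Set MonsterLabel}
    (h : ∀ l, l ∉ s → component i e x l = 0) : x ∈ adEigenspaces ℝ (axis (i, e)) s := by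
  have key : ∀ l, component i e x l ∈ adEigenspaces ℝ (axis (i, e)) s := by
    intro l
    by_cases hl : l ∈ s
    · exact adEigenspace_le hl (component_mem x l)
    · rw [h l hl]; exact Submodule.zero_mem _
  rw [← sum_component (i := i) (e := e) x]
  exact Submodule.add_mem _ (Submodule.add_mem _ (Submodule.add_mem _ (key _) (key _)) (key _))
    (key _)

theorem isInternal : DirectSum.IsInternal (adEigenspace ℝ (axis (i, e))) := by
  rw [DirectSum.isInternal_submodule_iff_iSupIndep_and_iSup_eq_top]
  constructor
  · apply (Module.End.eigenspaces_iSupIndep (LinearMap.mulLeft ℝ (axis (i, e)))).comp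
      (f := fun l : MonsterLabel => algebraMap ℝ ℝ l.val)
    intro l m h
    cases l <;> cases m <;> simp [MonsterLabel.val] at h ⊢
  · rw [eq_top_iff]
    rintro x -
    have := mem_adEigenspaces (i := i) (e := e) (x := x) (s := Set.univ) (by simp)
    simpa [adEigenspaces] using this

theorem mem_even {x : Model4B} (h : ∀ j, j ≠ i → δ j x = 0) :
    x ∈ adEigenspaces ℝ (axis (i, e)) {.one, .zero, .quarter} := by
  apply mem_adEigenspaces
  rintro (_ | _ | _ | _) hl <;> simp at hl
  apply ext' <;> simp [component]
  exact fun j hj => h j hj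

theorem mem_one_zero {x : Model4B} (h : ∀ j, j ≠ i → δ j x = 0)
    (hq : δ i x - ((e : ℤ) : ℝ) * φ i x + ((e : ℤ) : ℝ) * γ x = 0) :
    x ∈ adEigenspaces ℝ (axis (i, e)) {.one, .zero} := by
  apply mem_adEigenspaces
  rintro (_ | _ | _ | _) hl <;> simp at hl
  · apply ext' <;> simp [component, quarterCoord, hq]
  · apply ext' <;> simp [component]
    exact fun j hj => h j hj

theorem isPrimitiveAxis : IsPrimitiveAxis ℝ (axis (i, e)) := by
  apply le_antisymm
  · intro x hx
    rw [Submodule.mem_span_singleton]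
    refine ⟨2 * (((e : ℤ) : ℝ) * δ i x), ?_⟩
    obtain ⟨h1, h2, h3⟩ := mem_one.1 hx
    apply ext'
    · intro j
      by_cases hj : j = i
      · subst hj; rw [map_smul, φ_axis_self, h1, smul_eq_mul]; ring
      · simp [φ_axis_of_ne hj, h3 j hj]
    · intro j
      by_cases hj : j = i
      · subst hj; rw [map_smul, δ_axis_self, smul_eq_mul]
        linear_combination δ j x * sq_sign e
      · simp [δ_axis_of_ne hj, h3 j hj]
    · rw [map_smul, γ_axis, h2, smul_eq_mul]; ring
  · rw [Submodule.span_singleton_le_iff_mem]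
    exact axis_mem_one

theorem fusion_one {m : MonsterLabel} {u v : Model4B} (hu : u ∈ adEigenspace ℝ (axis (i, e)) .one)
    (hv : v ∈ adEigenspace ℝ (axis (i, e)) m) :
    u * v ∈ adEigenspaces ℝ (axis (i, e)) (MonsterLabel.star .one m) := by
  rw [isPrimitiveAxis, Submodule.mem_span_singleton] at hu
  obtain ⟨r, rfl⟩ := hu
  rw [smul_mul_assoc]
  apply Submodule.smul_mem
  have key : axis (i, e) * v ∈ adEigenspace ℝ (axis (i, e)) m := by
    rw [mem_adEigenspace_iff.1 hv]
    exact Submodule.smul_mem _ _ hv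
  cases m
  case zero => rw [mem_adEigenspace_zero.1 hv]; exact Submodule.zero_mem _
  all_goals
    rw [MonsterLabel.star, adEigenspaces_singleton]
    exact key

theorem star_comm (l m : MonsterLabel) : MonsterLabel.star l m = MonsterLabel.star m l := by
  cases l <;> cases m <;> rfl

theorem sum_eq_single {f : Fin 3 → ℝ} (h : ∀ j, j ≠ i → f j = 0) : ∑ j, f j = f i :=
  Finset.sum_eq_single i (fun j _ hj => h j hj) (by simp)

/-- The `1`- and `1/4`-spaces are lines in the block `f_i, d_i, a_ρ`; the `0`-space is a line in it
plus the `f_j`, and the `1/32`-space is spanned by the `d_j`, `j ≠ i`. Each rule becomes a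
coordinate identity modulo `e * e = 1`. -/
theorem fusion (l m : MonsterLabel) (u : Model4B) (hu : u ∈ adEigenspace ℝ (axis (i, e)) l)
    (v : Model4B) (hv : v ∈ adEigenspace ℝ (axis (i, e)) m) :
    u * v ∈ adEigenspaces ℝ (axis (i, e)) (MonsterLabel.star l m) := by
  have he := sq_sign e
  have zero_quarter : ∀ u ∈ adEigenspace ℝ (axis (i, e)) .zero,
      ∀ v ∈ adEigenspace ℝ (axis (i, e)) .quarter,
      u * v ∈ adEigenspaces ℝ (axis (i, e)) {.quarter} := by
    intro u hu v hv
    rw [adEigenspaces_singleton, mem_quarter]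
    obtain ⟨u1, u2, u3⟩ := mem_zero.1 hu
    obtain ⟨v1, v2, v3⟩ := mem_quarter.1 hv
    refine ⟨?_, ?_, fun j hj => ⟨?_, ?_⟩⟩
    · rw [φ_mul, δ_mul, u1, u2, v1, v2]
      linear_combination (-15 / 16 * δ i u * δ i v) * he
    · rw [γ_mul, δ_mul, sum_eq_single (i := i) (fun j hj => by simp [u3 j hj]), u1, u2, v1, v2]
      linear_combination (-7 / 16 * δ i u * δ i v) * he
    · simp [u3 j hj, v3 j hj]
    · simp [u3 j hj, v3 j hj]
  have zero_odd : ∀ u ∈ adEigenspace ℝ (axis (i, e)) .zero,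
      ∀ v ∈ adEigenspace ℝ (axis (i, e)) .thirtySecond,
      u * v ∈ adEigenspaces ℝ (axis (i, e)) {.thirtySecond} := by
    intro u hu v hv
    rw [adEigenspaces_singleton, mem_thirtySecond]
    obtain ⟨u1, u2, u3⟩ := mem_zero.1 hu
    obtain ⟨v1, v2, v3⟩ := mem_thirtySecond.1 hv
    have hs : ∀ j, δ j u * δ j v = 0 := by
      intro j
      by_cases hj : j = i
      · subst hj; rw [v2, mul_zero]
      · rw [u3 j hj, zero_mul]
    exact ⟨fun j => by simp [v1, hs], by simp [v1, v2, v3], by simp [v3, hs]⟩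
  have quarter_odd : ∀ u ∈ adEigenspace ℝ (axis (i, e)) .quarter,
      ∀ v ∈ adEigenspace ℝ (axis (i, e)) .thirtySecond,
      u * v ∈ adEigenspaces ℝ (axis (i, e)) {.thirtySecond} := by
    intro u hu v hv
    rw [adEigenspaces_singleton, mem_thirtySecond]
    obtain ⟨u1, u2, u3⟩ := mem_quarter.1 hu
    obtain ⟨v1, v2, v3⟩ := mem_thirtySecond.1 hv
    have hs : ∀ j, δ j u * δ j v = 0 := by
      intro j
      by_cases hj : j = i
      · subst hj; rw [v2, mul_zero]
      · rw [(u3 j hj).2, zero_mul]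
    exact ⟨fun j => by simp [v1, hs], by simp [v1, v2, v3], by simp [v3, hs]⟩
  cases l <;> cases m
  case one.one | one.zero | one.quarter | one.thirtySecond => exact fusion_one hu hv
  case zero.one | quarter.one | thirtySecond.one =>
    rw [mul_comm, star_comm]; exact fusion_one hv hu
  case zero.zero =>
    rw [MonsterLabel.star, adEigenspaces_singleton, mem_zero]
    obtain ⟨u1, u2, u3⟩ := mem_zero.1 hu
    obtain ⟨v1, v2, v3⟩ := mem_zero.1 hv
    refine ⟨?_, ?_, fun j hj => ?_⟩
    · rw [φ_mul, δ_mul, u1, u2, v1, v2]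
      linear_combination (-15 / 16 * δ i u * δ i v) * he
    · rw [γ_mul, δ_mul, sum_eq_single (i := i) (fun j hj => by simp [u3 j hj]), u1, u2, v1, v2]
      linear_combination (-7 / 16 * δ i u * δ i v) * he
    · simp [u3 j hj, v3 j hj]
  case zero.quarter => exact zero_quarter u hu v hv
  case quarter.zero => rw [mul_comm]; exact zero_quarter v hv u hu
  case zero.thirtySecond => exact zero_odd u hu v hv
  case thirtySecond.zero => rw [mul_comm]; exact zero_odd v hv u hu
  case quarter.thirtySecond => exact quarter_odd u hu v hv
  case thirtySecond.quarter => rw [mul_comm]; exact quarter_odd v hv u hu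
  case quarter.quarter =>
    obtain ⟨u1, u2, u3⟩ := mem_quarter.1 hu
    obtain ⟨v1, v2, v3⟩ := mem_quarter.1 hv
    apply mem_one_zero
    · intro j hj; simp [u3 j hj, v3 j hj]
    · rw [φ_mul, δ_mul, γ_mul, sum_eq_single (i := i) (fun j hj => by simp [u3 j hj]), u1, u2,
        v1, v2]
      linear_combination (3 / 2 * ((e : ℤ) : ℝ) * δ i u * δ i v) * he
  case thirtySecond.thirtySecond =>
    obtain ⟨u1, u2, u3⟩ := mem_thirtySecond.1 hu
    obtain ⟨v1, v2, v3⟩ := mem_thirtySecond.1 hv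
    apply mem_even
    intro j hj
    simp [u1, v1, u3, v3]

theorem isMonsterAxis : IsMonsterAxis ℝ (axis (i, e)) where
  idem := mem_adEigenspace_one.1 axis_mem_one
  semisimple := isInternal
  fusion := fusion

end Model4B

/-! ### Miyamoto involutions, dihedral subalgebra and generation of the model. -/

namespace Model4B

/-- The Miyamoto involution of the axes `a_{±i}`. -/
noncomputable def reflection (i : Fin 3) : Model4B ≃ₗ[ℝ] Model4B :=
  LinearEquiv.ofInvolutive
    { toFun := fun x => mk (fun j => φ j x) (fun j => if j = i then δ j x else -δ j x) (γ x)
      map_add' := fun x y => by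
        apply ext'
        · simp
        · intro j; by_cases hj : j = i <;> simp [hj]; ring
        · simp
      map_smul' := fun r x => by
        apply ext'
        · simp
        · intro j; by_cases hj : j = i <;> simp [hj]
        · simp }
    (fun x => by
      apply ext'
      · simp
      · intro j; by_cases hj : j = i <;> simp [hj]
      · simp)

@[simp] theorem φ_reflection (i j : Fin 3) (x : Model4B) : φ j (reflection i x) = φ j x := rfl
@[simp] theorem δ_reflection (i j : Fin 3) (x : Model4B) :
    δ j (reflection i x) = if j = i then δ j x else -δ j x := rfl
@[simp] theorem γ_reflection (i : Fin 3) (x : Model4B) : γ (reflection i x) = γ x := rfl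

theorem isMiyamotoInvolution (i : Fin 3) (e : ℤˣ) :
    IsMiyamotoInvolution ℝ (axis (i, e)) (reflection i) := by
  have fix : ∀ x : Model4B, (∀ j, j ≠ i → δ j x = 0) → reflection i x = x := by
    intro x hx
    apply ext'
    · simp
    · intro j
      by_cases hj : j = i
      · simp [hj]
      · simp [hj, hx j hj]
    · simp
  constructor
  · have : adEigenspaces ℝ (axis (i, e)) {.one, .zero, .quarter} ≤
        LinearMap.eqLocus (reflection i).toLinearMap LinearMap.id := by
      refine iSup₂_le fun l hl x hx => ?_
      rcases hl with rfl | rfl | rfl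
      · exact fix x fun j hj => ((mem_one.1 hx).2.2 j hj).2
      · exact fix x (mem_zero.1 hx).2.2
      · exact fix x fun j hj => ((mem_quarter.1 hx).2.2 j hj).2
    exact fun v hv => this hv
  · intro x hx
    obtain ⟨h1, h2, h3⟩ := mem_thirtySecond.1 hx
    apply ext'
    · intro j; simp [h1]
    · intro j
      by_cases hj : j = i
      · subst hj; simp [h2]
      · simp [hj]
    · simp [h3]

theorem reflection_axis (p q : AxisIndex) : reflection p.1 (axis q) = axis (axisPerm p q) := by
  by_cases h : q.1 = p.1
  · apply ext' <;> simp [axis, axisPerm, h]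
    intro j; by_cases hj : j = p.1 <;> simp [hj]
  · apply ext' <;> simp [axis, axisPerm, h]
    intro j
    by_cases hj : j = q.1
    · subst hj; simp [h]; ring
    · simp [hj]

theorem φ_axis (j : Fin 3) (p : AxisIndex) : φ j (axis p) = if j = p.1 then 5 / 8 else 0 := by
  simp [axis, Pi.single_apply]

theorem δ_axis (j : Fin 3) (p : AxisIndex) :
    δ j (axis p) = if j = p.1 then ((p.2 : ℤ) : ℝ) / 2 else 0 := by
  simp [axis, Pi.single_apply]

theorem γ_axis' (p : AxisIndex) : γ (axis p) = 1 / 8 := rfl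

theorem axis_injective : Function.Injective axis := by
  rintro ⟨i, e⟩ ⟨j, d⟩ h
  have h1 := congrArg (φ i) h
  simp only [φ_axis, if_true] at h1
  have hij : i = j := by
    by_contra hij
    simp [hij] at h1
  subst hij
  have h2 := congrArg (δ i) h
  simp only [δ_axis, if_true] at h2
  have : (e : ℤ) = d := by
    have : ((e : ℤ) : ℝ) = (d : ℤ) := by linarith
    exact_mod_cast this
  rw [Units.ext this]

theorem form_axis (p : AxisIndex) : form (axis p) (axis p) = 1 := by
  obtain ⟨i, e⟩ := p
  have he := sq_sign e
  rw [form_apply, sum_eq_single (i := i) (fun j hj => by simp [φ_axis_of_ne hj, δ_axis_of_ne hj]),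
    φ_axis_self, δ_axis_self, γ_axis]
  linear_combination 7 / 16 * he

/-- The subspace of vectors with vanishing coordinates of index `2` is a subalgebra. -/
def subalgebra01 : NonUnitalSubalgebra ℝ Model4B where
  carrier := {x | φ 2 x = 0 ∧ δ 2 x = 0}
  add_mem' := by rintro x y ⟨h1, h2⟩ ⟨h3, h4⟩; simp_all
  zero_mem' := by simp
  mul_mem' := by rintro x y ⟨h1, h2⟩ ⟨h3, h4⟩; simp_all
  smul_mem' := by rintro r x ⟨h1, h2⟩; simp_all

theorem smul_axis_mul_axis :
    (8 : ℝ) • (axis (0, 1) * axis (0, -1)) = axis (0, 1) + axis (0, -1) - rho := by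
  apply ext' <;> simp [Fin.forall_fin_succ, φ_axis, δ_axis, γ_axis', rho] <;> norm_num

theorem isDihedral4B : IsDihedral4B ℝ form
    (axis (0, 1)) (axis (1, 1)) (axis (1, -1)) (axis (0, -1)) := by
  have e8 := smul_axis_mul_axis
  refine ⟨rho, ?_, ?_, ?_, ?_, ?_, ?_, ?_, ?_⟩
  · rw [Fintype.linearIndependent_iff]
    intro g hg
    simp only [Fin.sum_univ_five, Matrix.cons_val] at hg
    have h1 := congrArg (φ 0) hg
    have h2 := congrArg (φ 1) hg
    have h3 := congrArg (δ 0) hg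
    have h4 := congrArg (δ 1) hg
    have h5 := congrArg γ hg
    simp [φ_axis, δ_axis, γ_axis', rho] at h1 h2 h3 h4 h5
    intro i
    fin_cases i <;> simp <;> linarith
  · apply le_antisymm
    · rw [Submodule.span_le]
      have m0 : axis (0, 1) ∈ NonUnitalAlgebra.adjoin ℝ {axis (0, 1), axis (1, 1)} :=
        NonUnitalAlgebra.subset_adjoin ℝ (by simp)
      have m1 : axis (1, 1) ∈ NonUnitalAlgebra.adjoin ℝ {axis (0, 1), axis (1, 1)} :=
        NonUnitalAlgebra.subset_adjoin ℝ (by simp)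
      set S := NonUnitalAlgebra.adjoin ℝ {axis (0, 1), axis (1, 1)}
      -- `p = d_0 + d_1 + a_ρ`. The combination in `mq` is chosen so that it sends the axes of index
      -- `0` and `1` to `q0 = d_0 + a_ρ` and `q1 = d_1 + a_ρ`; linear combinations of `p`, `q0`,
      -- `q1` then give `a_ρ`, `d_0` and `d_1`.
      obtain ⟨p, hp⟩ : ∃ p, p = (64 : ℝ) • (axis (0, 1) * axis (1, 1)) := ⟨_, rfl⟩
      have mp : p ∈ S := by rw [hp]; exact SMulMemClass.smul_mem _ (mul_mem m0 m1)
      have hp' : p = mk 0 ![1, 1, 0] 1 := by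
        rw [hp]
        apply ext' <;>
          simp [Fin.forall_fin_succ, φ_axis, δ_axis, γ_axis'] <;> norm_num
      have mq : ∀ a ∈ S, (1 / 7 : ℝ) • ((32 : ℝ) • (a * p) - (24 : ℝ) • a - p) ∈ S := fun a ha =>
        SMulMemClass.smul_mem _ (sub_mem (sub_mem (SMulMemClass.smul_mem _ (mul_mem ha mp)) (SMulMemClass.smul_mem _ ha)) mp)
      obtain ⟨q0, hq0⟩ : ∃ q, q = (1 / 7 : ℝ) • ((32 : ℝ) • (axis (0, 1) * p) -
        (24 : ℝ) • axis (0, 1) - p) := ⟨_, rfl⟩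
      obtain ⟨q1, hq1⟩ : ∃ q, q = (1 / 7 : ℝ) • ((32 : ℝ) • (axis (1, 1) * p) -
        (24 : ℝ) • axis (1, 1) - p) := ⟨_, rfl⟩
      have mq0 : q0 ∈ S := hq0 ▸ mq _ m0
      have mq1 : q1 ∈ S := hq1 ▸ mq _ m1
      have hq0' : q0 = mk 0 ![1, 0, 0] 1 := by
        rw [hq0, hp']
        apply ext' <;>
          simp [Fin.forall_fin_succ, φ_axis, δ_axis, γ_axis'] <;> norm_num
      have hq1' : q1 = mk 0 ![0, 1, 0] 1 := by
        rw [hq1, hp']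
        apply ext' <;>
          simp [Fin.forall_fin_succ, φ_axis, δ_axis, γ_axis'] <;> norm_num
      have hr : rho = q0 + q1 - p := by
        rw [hq0', hq1', hp']
        apply ext' <;> simp [Fin.forall_fin_succ, rho]
      have h2 : axis (0, -1) = axis (0, 1) - (p - q1) := by
        rw [hq1', hp']
        apply ext' <;> simp [Fin.forall_fin_succ, φ_axis, δ_axis, γ_axis']
        norm_num
      have h3 : axis (1, -1) = axis (1, 1) - (p - q0) := by
        rw [hq0', hp']
        apply ext' <;> simp [Fin.forall_fin_succ, φ_axis, δ_axis, γ_axis']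
        norm_num
      rintro x (rfl | rfl | rfl | rfl | rfl)
      · rw [h3]; exact sub_mem m1 (sub_mem mp mq0)
      · exact m0
      · exact m1
      · rw [h2]; exact sub_mem m0 (sub_mem mp mq1)
      · rw [hr]; exact sub_mem (add_mem mq0 mq1) mp
    · have hle : NonUnitalAlgebra.adjoin ℝ {axis (0, 1), axis (1, 1)} ≤ subalgebra01 := by
        apply NonUnitalAlgebra.adjoin_le
        rintro x (rfl | rfl) <;> exact ⟨by simp [φ_axis], by simp [δ_axis]⟩
      intro x hx
      obtain ⟨h1, h2⟩ := hle hx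
      have : x = (4 / 5 * φ 1 x - δ 1 x) • axis (1, -1) + (4 / 5 * φ 0 x + δ 0 x) • axis (0, 1)
          + (4 / 5 * φ 1 x + δ 1 x) • axis (1, 1) + (4 / 5 * φ 0 x - δ 0 x) • axis (0, -1)
          + (γ x - 1 / 5 * (φ 0 x + φ 1 x)) • rho := by
        apply ext' <;> simp [Fin.forall_fin_succ, φ_axis, δ_axis, γ_axis', rho]
        · exact ⟨by ring, by ring, h1⟩
        · exact ⟨by ring, by ring, h2⟩
        · ring
      rw [this]
      have hm : ∀ y ∈ ({axis (1, -1), axis (0, 1), axis (1, 1), axis (0, -1), rho} :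
          Set Model4B), ∀ r : ℝ, r • y ∈ Submodule.span ℝ
            {axis (1, -1), axis (0, 1), axis (1, 1), axis (0, -1), rho} :=
        fun y hy r => Submodule.smul_mem _ _ (Submodule.subset_span hy)
      refine Submodule.add_mem _ (Submodule.add_mem _ (Submodule.add_mem _ (Submodule.add_mem _
        (hm _ ?_ _) (hm _ ?_ _)) (hm _ ?_ _)) (hm _ ?_ _)) (hm _ ?_ _) <;> simp
  · refine ⟨isMonsterAxis.idem, isMonsterAxis.idem, isMonsterAxis.idem, isMonsterAxis.idem, ?_⟩
    apply ext' <;> simp [rho]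
  · refine ⟨?_, ?_, ?_, ?_⟩ <;> apply ext' <;>
      simp [Fin.forall_fin_succ, φ_axis, δ_axis, γ_axis', rho] <;> norm_num
  · refine ⟨e8, ?_, ?_, ?_, ?_, ?_⟩ <;> apply ext' <;>
      simp [Fin.forall_fin_succ, φ_axis, δ_axis, γ_axis', rho] <;> norm_num
  · refine ⟨form_axis _, form_axis _, form_axis _, form_axis _, ?_⟩
    simp [form_apply, rho]
  · refine ⟨?_, ?_, ?_, ?_⟩ <;>
      simp [form_apply, φ_axis, δ_axis, γ_axis', Fin.sum_univ_three] <;> norm_num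
  · refine ⟨?_, ?_, ?_, ?_, ?_, ?_⟩ <;>
      simp [form_apply, φ_axis, δ_axis, γ_axis', rho, Fin.sum_univ_three] <;> norm_num

theorem eq_sum (x : Model4B) : x = ∑ j, ((4 / 5 * φ j x + δ j x) • axis (j, 1) +
    (4 / 5 * φ j x - δ j x) • axis (j, -1)) + (γ x - 1 / 5 * ∑ j, φ j x) • rho := by
  apply ext' <;> simp [Fin.forall_fin_succ, φ_axis, δ_axis, γ_axis', rho, Fin.sum_univ_three]
  · exact ⟨by ring, by ring, by ring⟩
  · exact ⟨by ring, by ring, by ring⟩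
  · ring

theorem adjoin_axis : NonUnitalAlgebra.adjoin ℝ (Set.range axis) = ⊤ := by
  rw [eq_top_iff]
  rintro x -
  set S := NonUnitalAlgebra.adjoin ℝ (Set.range axis)
  have hm : ∀ p, axis p ∈ S := fun p => NonUnitalAlgebra.subset_adjoin ℝ ⟨p, rfl⟩
  have hr : rho ∈ S := by
    have : rho = axis (0, 1) + axis (0, -1) - (8 : ℝ) • (axis (0, 1) * axis (0, -1)) := by
      rw [smul_axis_mul_axis]; abel
    rw [this]
    exact sub_mem (add_mem (hm _) (hm _)) (SMulMemClass.smul_mem _ (mul_mem (hm _) (hm _)))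
  rw [eq_sum x]
  exact add_mem (sum_mem fun j _ => add_mem (SMulMemClass.smul_mem _ (hm _)) (SMulMemClass.smul_mem _ (hm _)))
    (SMulMemClass.smul_mem _ hr)

end Model4B

/-! ### The model as a member of the class. -/

/-- The universal algebra of shape `4B`. -/
noncomputable def universal4B : MarkedFrobeniusAlgebra.{0} AxisIndex where
  R := ℝ
  M := Model4B
  gen := Model4B.axis
  form := Model4B.form
  form_assoc := Model4B.form_assoc
  adjoin_gen := Model4B.adjoin_axis
  adjoin_form := by
    rw [eq_top_iff]
    rintro r -
    exact Subalgebra.algebraMap_mem _ r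

theorem isShape4B_universal4B : IsShape4B universal4B where
  gen_injective := Model4B.axis_injective
  axis _ := Model4B.isMonsterAxis
  primitive _ := Model4B.isPrimitiveAxis
  form_axis := Model4B.form_axis
  miyamoto p := ⟨Model4B.reflection p.1, Model4B.isMiyamotoInvolution p.1 p.2,
    Model4B.reflection_axis p⟩
  shape := Model4B.isDihedral4B

theorem eq_algebraMap_smul {R M : Type*} [CommRing R] [Algebra ℝ R] [AddCommGroup M] [Module R M]
    {n : ℕ} (hn : n ≠ 0) (m : ℕ) {x y : M} (h : (n : R) • x = (m : R) • y) :
    x = algebraMap ℝ R (m / n) • y := by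
  have hu : IsUnit (n : R) := isUnit_natCast_of_real hn
  apply hu.smul_left_cancel.1
  rw [h, smul_smul, ← map_natCast (algebraMap ℝ R) n, ← map_mul,
    mul_div_cancel₀ _ (Nat.cast_ne_zero.2 hn), map_natCast]

/-! ### The morphism from the model to an algebra with the table. -/

namespace HasTable4B

variable {𝓑 : MarkedFrobeniusAlgebra.{v} AxisIndex} {c : 𝓑.M}

/-- The sum of a pair of axes. -/
def axisSum (𝓑 : MarkedFrobeniusAlgebra.{v} AxisIndex) (j : Fin 3) : 𝓑.M :=
  𝓑.gen (j, 1) + 𝓑.gen (j, -1)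

/-- The difference of a pair of axes. -/
def axisDiff (𝓑 : MarkedFrobeniusAlgebra.{v} AxisIndex) (j : Fin 3) : 𝓑.M :=
  𝓑.gen (j, 1) - 𝓑.gen (j, -1)

/-- The idempotent that corresponds to a pair of axes. -/
noncomputable def pairIdem (𝓑 : MarkedFrobeniusAlgebra.{v} AxisIndex) (c : 𝓑.M) (j : Fin 3) : 𝓑.M :=
  algebraMap ℝ 𝓑.R (4 / 5) • axisSum 𝓑 j - algebraMap ℝ 𝓑.R (1 / 5) • c

theorem five_smul_pairIdem (c : 𝓑.M) (j : Fin 3) :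
    (5 : 𝓑.R) • pairIdem 𝓑 c j = (4 : 𝓑.R) • axisSum 𝓑 j - c := by
  rw [pairIdem, smul_sub, smul_smul, smul_smul, ← map_ofNat (algebraMap ℝ 𝓑.R) 5, ← map_mul,
    ← map_mul, ← map_ofNat (algebraMap ℝ 𝓑.R) 4]
  norm_num

section Products

variable (h : HasTable4B 𝓑 c)
include h

theorem sum_mul_sum (j : Fin 3) :
    (4 : 𝓑.R) • (axisSum 𝓑 j * axisSum 𝓑 j) = (5 : 𝓑.R) • axisSum 𝓑 j - c := by
  have := h.mul_neg j 1
  simp only [axisSum, mul_add, add_mul, h.idem, mul_comm (𝓑.gen (j, -1)) (𝓑.gen (j, 1))]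
  linear_combination (norm := module) this

theorem sum_mul_diff (j : Fin 3) : axisSum 𝓑 j * axisDiff 𝓑 j = axisDiff 𝓑 j := by
  simp only [axisSum, axisDiff, mul_sub, add_mul, h.idem, mul_comm (𝓑.gen (j, -1)) (𝓑.gen (j, 1))]
  module

theorem diff_mul_diff (j : Fin 3) :
    (4 : 𝓑.R) • (axisDiff 𝓑 j * axisDiff 𝓑 j) = (3 : 𝓑.R) • axisSum 𝓑 j + c := by
  have := h.mul_neg j 1
  simp only [axisSum, axisDiff, mul_sub, sub_mul, h.idem, mul_comm (𝓑.gen (j, -1)) (𝓑.gen (j, 1))]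
  linear_combination (norm := module) -this

theorem mul_c_one (j : Fin 3) :
    (8 : 𝓑.R) • (𝓑.gen (j, 1) * c) = 𝓑.gen (j, 1) + c - 𝓑.gen (j, -1) ∧
    (8 : 𝓑.R) • (𝓑.gen (j, -1) * c) = 𝓑.gen (j, -1) + c - 𝓑.gen (j, 1) := by
  have h2 := h.mul_c j (-1)
  rw [neg_neg] at h2
  exact ⟨h.mul_c j 1, h2⟩

theorem sum_mul_c (j : Fin 3) : (4 : 𝓑.R) • (axisSum 𝓑 j * c) = c := by
  obtain ⟨h1, h2⟩ := h.mul_c_one j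
  apply smul_cancel_of_real 𝓑.R (n := 2) (by norm_num)
  push_cast
  simp only [axisSum, add_mul]
  linear_combination (norm := module) h1 + h2

theorem diff_mul_c (j : Fin 3) : (4 : 𝓑.R) • (axisDiff 𝓑 j * c) = axisDiff 𝓑 j := by
  obtain ⟨h1, h2⟩ := h.mul_c_one j
  apply smul_cancel_of_real 𝓑.R (n := 2) (by norm_num)
  push_cast
  simp only [axisDiff, sub_mul]
  linear_combination (norm := module) h1 - h2

theorem mul_of_ne {i j : Fin 3} (hij : i ≠ j) :
    (16 : 𝓑.R) • (axisSum 𝓑 i * axisSum 𝓑 j) = c ∧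
    (16 : 𝓑.R) • (axisSum 𝓑 i * axisDiff 𝓑 j) = axisDiff 𝓑 j ∧
    axisDiff 𝓑 i * axisDiff 𝓑 j = 0 := by
  have h1 := h.mul_ne i j 1 1 hij
  have h2 := h.mul_ne i j 1 (-1) hij
  have h3 := h.mul_ne i j (-1) 1 hij
  have h4 := h.mul_ne i j (-1) (-1) hij
  rw [neg_neg] at h2 h3 h4
  refine ⟨?_, ?_, ?_⟩
  · apply smul_cancel_of_real 𝓑.R (n := 4) (by norm_num)
    push_cast
    simp only [axisSum, add_mul, mul_add]
    linear_combination (norm := module) h1 + h2 + h3 + h4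
  · apply smul_cancel_of_real 𝓑.R (n := 4) (by norm_num)
    push_cast
    simp only [axisSum, axisDiff, add_mul, mul_sub]
    linear_combination (norm := module) h1 - h2 + h3 - h4
  · apply smul_cancel_of_real 𝓑.R (n := 64) (by norm_num)
    push_cast
    simp only [axisDiff, sub_mul, mul_sub]
    linear_combination (norm := module) h1 - h2 - h3 + h4

theorem idem_mul_c (j : Fin 3) : pairIdem 𝓑 c j * c = 0 := by
  apply smul_cancel_of_real 𝓑.R (n := 5) (by norm_num)
  push_cast
  rw [← smul_mul_assoc, five_smul_pairIdem, sub_mul, smul_mul_assoc, h.sum_mul_c, h.idem_c]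
  simp

theorem idem_mul_idem (j : Fin 3) : pairIdem 𝓑 c j * pairIdem 𝓑 c j = pairIdem 𝓑 c j := by
  apply smul_cancel_of_real 𝓑.R (n := 5) (by norm_num)
  push_cast
  conv_lhs => rw [← smul_mul_assoc, five_smul_pairIdem, sub_mul, mul_comm c, h.idem_mul_c]
  apply smul_cancel_of_real 𝓑.R (n := 5) (by norm_num)
  push_cast
  rw [five_smul_pairIdem, sub_zero, ← mul_smul_comm, five_smul_pairIdem]
  simp only [smul_mul_assoc, mul_sub, mul_smul_comm]
  linear_combination (norm := module) (4 : 𝓑.R) • h.sum_mul_sum j - h.sum_mul_c j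

theorem idem_mul_diff (j : Fin 3) :
    pairIdem 𝓑 c j * axisDiff 𝓑 j = algebraMap ℝ 𝓑.R (3 / 4) • axisDiff 𝓑 j := by
  refine eq_algebraMap_smul (n := 4) (by norm_num) 3 ?_
  apply smul_cancel_of_real 𝓑.R (n := 5) (by norm_num)
  push_cast
  rw [smul_comm, ← smul_mul_assoc, five_smul_pairIdem, sub_mul, smul_mul_assoc, h.sum_mul_diff,
    mul_comm c]
  linear_combination (norm := module) -h.diff_mul_c j

theorem diff_mul_diff_idem (j : Fin 3) : axisDiff 𝓑 j * axisDiff 𝓑 j =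
    algebraMap ℝ 𝓑.R (15 / 16) • pairIdem 𝓑 c j + algebraMap ℝ 𝓑.R (7 / 16) • c := by
  have h1 : axisDiff 𝓑 j * axisDiff 𝓑 j =
      algebraMap ℝ 𝓑.R (1 / 16) • ((15 : 𝓑.R) • pairIdem 𝓑 c j + (7 : 𝓑.R) • c) := by
    have := five_smul_pairIdem c j
    have := eq_algebraMap_smul (R := 𝓑.R) (n := 16) (by norm_num) 1
      (x := axisDiff 𝓑 j * axisDiff 𝓑 j) (y := (15 : 𝓑.R) • pairIdem 𝓑 c j + (7 : 𝓑.R) • c) (by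
        push_cast
        linear_combination (norm := module) (4 : 𝓑.R) • h.diff_mul_diff j - (3 : 𝓑.R) • this)
    simpa using this
  rw [h1, smul_add, smul_smul, smul_smul, ← map_ofNat (algebraMap ℝ 𝓑.R) 15, ← map_mul,
    ← map_ofNat (algebraMap ℝ 𝓑.R) 7, ← map_mul]
  norm_num

theorem diff_mul_c' (j : Fin 3) : axisDiff 𝓑 j * c = algebraMap ℝ 𝓑.R (1 / 4) • axisDiff 𝓑 j := by
  have := eq_algebraMap_smul (R := 𝓑.R) (n := 4) (by norm_num) 1
    (x := axisDiff 𝓑 j * c) (y := axisDiff 𝓑 j) (by push_cast; rw [h.diff_mul_c, one_smul])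
  simpa using this

theorem idem_mul_of_ne {i j : Fin 3} (hij : i ≠ j) :
    pairIdem 𝓑 c i * pairIdem 𝓑 c j = 0 ∧ pairIdem 𝓑 c i * axisDiff 𝓑 j = 0 := by
  obtain ⟨h1, h2, -⟩ := h.mul_of_ne hij
  constructor
  · apply smul_cancel_of_real 𝓑.R (n := 25) (by norm_num)
    push_cast
    have : (25 : 𝓑.R) • (pairIdem 𝓑 c i * pairIdem 𝓑 c j) =
        ((5 : 𝓑.R) • pairIdem 𝓑 c i) * ((5 : 𝓑.R) • pairIdem 𝓑 c j) := by
      rw [smul_mul_assoc, mul_smul_comm]; module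
    rw [this, five_smul_pairIdem, five_smul_pairIdem]
    simp only [smul_mul_assoc, mul_sub, sub_mul, mul_smul_comm, h.idem_c, mul_comm c]
    linear_combination (norm := module) h1 - h.sum_mul_c i - h.sum_mul_c j
  · apply smul_cancel_of_real 𝓑.R (n := 20) (by norm_num)
    push_cast
    have : (20 : 𝓑.R) • (pairIdem 𝓑 c i * axisDiff 𝓑 j) =
        (4 : 𝓑.R) • (((5 : 𝓑.R) • pairIdem 𝓑 c i) * axisDiff 𝓑 j) := by
      rw [smul_mul_assoc]; module
    rw [this, five_smul_pairIdem]
    simp only [smul_mul_assoc, sub_mul, mul_comm c]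
    linear_combination (norm := module) h2 - h.diff_mul_c j

end Products

/-- The additive map from the model to an algebra of shape `4B`. -/
noncomputable def homMap (𝓑 : MarkedFrobeniusAlgebra.{v} AxisIndex) (c : 𝓑.M) :
    Model4B →+ 𝓑.M where
  toFun x := ∑ j, (algebraMap ℝ 𝓑.R (Model4B.φ j x) • pairIdem 𝓑 c j +
    algebraMap ℝ 𝓑.R (Model4B.δ j x) • axisDiff 𝓑 j) + algebraMap ℝ 𝓑.R (Model4B.γ x) • c
  map_zero' := by simp
  map_add' x y := by
    simp only [map_add, Fin.sum_univ_three]; module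

theorem homMap_apply (x : Model4B) : homMap 𝓑 c x =
    ∑ j, (algebraMap ℝ 𝓑.R (Model4B.φ j x) • pairIdem 𝓑 c j +
    algebraMap ℝ 𝓑.R (Model4B.δ j x) • axisDiff 𝓑 j) + algebraMap ℝ 𝓑.R (Model4B.γ x) • c := rfl

theorem homMap_smul (r : ℝ) (x : Model4B) :
    homMap 𝓑 c (r • x) = algebraMap ℝ 𝓑.R r • homMap 𝓑 c x := by
  simp only [homMap_apply, map_smul, smul_eq_mul, map_mul, Fin.sum_univ_three]; module

theorem homMap_mul (h : HasTable4B 𝓑 c) (x y : Model4B) :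
    homMap 𝓑 c (x * y) = homMap 𝓑 c x * homMap 𝓑 c y := by
  have i01 := h.idem_mul_of_ne (i := 0) (j := 1) (by decide)
  have i02 := h.idem_mul_of_ne (i := 0) (j := 2) (by decide)
  have i10 := h.idem_mul_of_ne (i := 1) (j := 0) (by decide)
  have i12 := h.idem_mul_of_ne (i := 1) (j := 2) (by decide)
  have i20 := h.idem_mul_of_ne (i := 2) (j := 0) (by decide)
  have i21 := h.idem_mul_of_ne (i := 2) (j := 1) (by decide)
  have d01 := (h.mul_of_ne (i := 0) (j := 1) (by decide)).2.2
  have d02 := (h.mul_of_ne (i := 0) (j := 2) (by decide)).2.2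
  have d12 := (h.mul_of_ne (i := 1) (j := 2) (by decide)).2.2
  have dd := fun (i j : Fin 3) => mul_comm (axisDiff 𝓑 i) (axisDiff 𝓑 j)
  have di := fun (i j : Fin 3) => mul_comm (axisDiff 𝓑 i) (pairIdem 𝓑 c j)
  simp only [homMap_apply, Model4B.φ_mul, Model4B.δ_mul, Model4B.γ_mul, map_add, map_mul,
    Fin.sum_univ_three, add_mul, mul_add, smul_mul_assoc, mul_smul_comm, i01, i02, i10, i12, i20,
    i21, d01, d02, d12, dd 1 0, dd 2 0, dd 2 1, di, mul_comm c, h.idem_mul_c, h.idem_mul_idem,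
    h.idem_mul_diff, h.diff_mul_diff_idem, h.diff_mul_c', h.idem_c]
  module

end HasTable4B

namespace HasTable4B

variable {𝓑 : MarkedFrobeniusAlgebra.{v} AxisIndex} {c : 𝓑.M}

theorem homMap_axis (p : AxisIndex) : homMap 𝓑 c (Model4B.axis p) = 𝓑.gen p := by
  obtain ⟨i, e⟩ := p
  have hsum : ∑ j, (algebraMap ℝ 𝓑.R (Model4B.φ j (Model4B.axis (i, e))) • pairIdem 𝓑 c j +
      algebraMap ℝ 𝓑.R (Model4B.δ j (Model4B.axis (i, e))) • axisDiff 𝓑 j) =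
      algebraMap ℝ 𝓑.R (5 / 8) • pairIdem 𝓑 c i +
      algebraMap ℝ 𝓑.R (((e : ℤ) : ℝ) / 2) • axisDiff 𝓑 i := by
    rw [Finset.sum_eq_single i]
    · rw [Model4B.φ_axis_self, Model4B.δ_axis_self]
    · intro j _ hj
      rw [Model4B.φ_axis_of_ne hj, Model4B.δ_axis_of_ne hj]
      simp
    · simp
  have h2 : (2 : 𝓑.R) • (algebraMap ℝ 𝓑.R (1 / 2) • axisDiff 𝓑 i) = axisDiff 𝓑 i := by
    simpa using nsmul_algebraMap_inv (R := 𝓑.R) (n := 2) (by norm_num) (axisDiff 𝓑 i)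
  have h8 : ∀ x : 𝓑.M, (8 : 𝓑.R) • (algebraMap ℝ 𝓑.R (1 / 8) • x) = x := fun x => by
    simpa using nsmul_algebraMap_inv (R := 𝓑.R) (n := 8) (by norm_num) x
  have h58 : algebraMap ℝ 𝓑.R (5 / 8) • pairIdem 𝓑 c i =
      algebraMap ℝ 𝓑.R (1 / 8) • ((4 : 𝓑.R) • axisSum 𝓑 i - c) := by
    rw [← five_smul_pairIdem, smul_smul, ← map_ofNat (algebraMap ℝ 𝓑.R) 5, ← map_mul]
    norm_num
  rw [homMap_apply, hsum, Model4B.γ_axis, h58]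
  apply smul_cancel_of_real 𝓑.R (n := 8) (by norm_num)
  push_cast
  rcases Int.units_eq_one_or e with rfl | rfl
  · simp only [Units.val_one, Int.cast_one, smul_add, h8]
    have : (8 : 𝓑.R) • (algebraMap ℝ 𝓑.R (1 / 2) • axisDiff 𝓑 i) = (4 : 𝓑.R) • axisDiff 𝓑 i := by
      linear_combination (norm := module) (4 : 𝓑.R) • h2
    rw [this, axisSum, axisDiff]
    module
  · simp only [Units.val_neg, Units.val_one, Int.cast_neg, Int.cast_one, neg_div, map_neg,
      smul_add, h8]
    have : (8 : 𝓑.R) • (-algebraMap ℝ 𝓑.R (1 / 2) • axisDiff 𝓑 i) =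
        (-4 : 𝓑.R) • axisDiff 𝓑 i := by
      linear_combination (norm := module) (-4 : 𝓑.R) • h2
    rw [this, axisSum, axisDiff]
    module

theorem eq_algebraMap {R : Type*} [CommRing R] [Algebra ℝ R] {n : ℕ} (hn : n ≠ 0) (m : ℕ) {x : R}
    (h : (n : R) * x = m) : x = algebraMap ℝ R (m / n) := by
  have := eq_algebraMap_smul (R := R) (M := R) hn m (x := x) (y := 1) (by simpa only [smul_eq_mul, mul_one] using h)
  simpa only [smul_eq_mul, mul_one] using this

section Form

variable (h : HasTable4B 𝓑 c)
include h

theorem form_diff_c (j : Fin 3) :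
    𝓑.form (axisDiff 𝓑 j) c = 0 ∧ 𝓑.form c (axisDiff 𝓑 j) = 0 := by
  obtain ⟨h1, h2⟩ := h.form_gen_c j 1
  obtain ⟨h3, h4⟩ := h.form_gen_c j (-1)
  constructor
  · apply mul_cancel_of_real (n := 8) (by norm_num)
    simp only [axisDiff, map_sub, LinearMap.sub_apply]
    push_cast
    linear_combination h1 - h3
  · apply mul_cancel_of_real (n := 8) (by norm_num)
    simp only [axisDiff, map_sub]
    push_cast
    linear_combination h2 - h4

theorem form_idem_c (j : Fin 3) :
    𝓑.form (pairIdem 𝓑 c j) c = 0 ∧ 𝓑.form c (pairIdem 𝓑 c j) = 0 := by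
  constructor
  · have := 𝓑.form_assoc (pairIdem 𝓑 c j) c c
    rwa [h.idem_c, h.idem_mul_c, map_zero, LinearMap.zero_apply] at this
  · have := 𝓑.form_assoc c c (pairIdem 𝓑 c j)
    rw [h.idem_c, mul_comm, h.idem_mul_c, map_zero] at this
    exact this.symm

theorem form_diff_diff (j : Fin 3) :
    𝓑.form (axisDiff 𝓑 j) (axisDiff 𝓑 j) = algebraMap ℝ 𝓑.R (7 / 4) := by
  have h1 := h.form_neg j 1
  have h2 := h.form_neg j (-1)
  rw [neg_neg] at h2
  have := eq_algebraMap (R := 𝓑.R) (n := 8) (by norm_num) 14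
    (x := 𝓑.form (axisDiff 𝓑 j) (axisDiff 𝓑 j)) (by
      simp only [axisDiff, map_sub, LinearMap.sub_apply, h.form_self]
      push_cast
      linear_combination -h1 - h2)
  rw [this]
  norm_num

theorem form_idem_idem (j : Fin 3) :
    𝓑.form (pairIdem 𝓑 c j) (pairIdem 𝓑 c j) = algebraMap ℝ 𝓑.R (7 / 5) := by
  have h1 := h.form_neg j 1
  have h2 := h.form_neg j (-1)
  rw [neg_neg] at h2
  have e1 : 5 * 𝓑.form (pairIdem 𝓑 c j) (pairIdem 𝓑 c j) =
      4 * 𝓑.form (pairIdem 𝓑 c j) (axisSum 𝓑 j) := by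
    have := congrArg (𝓑.form (pairIdem 𝓑 c j)) (five_smul_pairIdem c j)
    simpa [(h.form_idem_c j).1] using this
  have e2 : 5 * 𝓑.form (pairIdem 𝓑 c j) (axisSum 𝓑 j) =
      4 * 𝓑.form (axisSum 𝓑 j) (axisSum 𝓑 j) - 𝓑.form c (axisSum 𝓑 j) := by
    have := congrArg (fun x => 𝓑.form x (axisSum 𝓑 j)) (five_smul_pairIdem c j)
    simpa using this
  have e3 : 4 * 𝓑.form c (axisSum 𝓑 j) = 1 := by
    have h3 := (h.form_gen_c j 1).2
    have h4 := (h.form_gen_c j (-1)).2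
    apply mul_cancel_of_real (n := 2) (by norm_num)
    simp only [axisSum, map_add]
    push_cast
    linear_combination h3 + h4
  have e4 : 8 * 𝓑.form (axisSum 𝓑 j) (axisSum 𝓑 j) = 18 := by
    simp only [axisSum, map_add, LinearMap.add_apply, h.form_self]
    linear_combination h1 + h2
  have := eq_algebraMap (R := 𝓑.R) (n := 25) (by norm_num) 35
    (x := 𝓑.form (pairIdem 𝓑 c j) (pairIdem 𝓑 c j)) (by
      push_cast
      linear_combination 5 * e1 + 4 * e2 + 2 * e4 - e3)
  rw [this]
  norm_num

/-- By associativity, multiplication by `f_j` is self-adjoint for the form, and `f_j`, `d_j` are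
eigenvectors for `1` and `3/4`, hence orthogonal. -/
theorem form_idem_diff (j : Fin 3) :
    𝓑.form (pairIdem 𝓑 c j) (axisDiff 𝓑 j) = 0 ∧ 𝓑.form (axisDiff 𝓑 j) (pairIdem 𝓑 c j) = 0 := by
  have h34 : (4 : 𝓑.R) * algebraMap ℝ 𝓑.R (3 / 4) = 3 := by
    rw [← map_ofNat (algebraMap ℝ 𝓑.R) 4, ← map_mul, ← map_ofNat (algebraMap ℝ 𝓑.R) 3]
    norm_num
  constructor
  · have e1 := 𝓑.form_assoc (pairIdem 𝓑 c j) (pairIdem 𝓑 c j) (axisDiff 𝓑 j)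
    rw [h.idem_mul_idem, h.idem_mul_diff, map_smul, smul_eq_mul] at e1
    linear_combination -4 * e1 + 𝓑.form (pairIdem 𝓑 c j) (axisDiff 𝓑 j) * h34
  · have e1 := 𝓑.form_assoc (axisDiff 𝓑 j) (pairIdem 𝓑 c j) (pairIdem 𝓑 c j)
    rw [h.idem_mul_idem, mul_comm, h.idem_mul_diff, map_smul, LinearMap.smul_apply,
      smul_eq_mul] at e1
    linear_combination 4 * e1 + 𝓑.form (axisDiff 𝓑 j) (pairIdem 𝓑 c j) * h34

/-- The same orthogonality argument with eigenvalues `1` and `0` of `f_i`; for two differences the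
values come from the table. -/
theorem form_of_ne {i j : Fin 3} (hij : i ≠ j) :
    𝓑.form (pairIdem 𝓑 c i) (pairIdem 𝓑 c j) = 0 ∧ 𝓑.form (pairIdem 𝓑 c i) (axisDiff 𝓑 j) = 0 ∧
    𝓑.form (axisDiff 𝓑 j) (pairIdem 𝓑 c i) = 0 ∧ 𝓑.form (axisDiff 𝓑 i) (axisDiff 𝓑 j) = 0 := by
  obtain ⟨h1, h2⟩ := h.idem_mul_of_ne hij
  refine ⟨?_, ?_, ?_, ?_⟩
  · rw [← h.idem_mul_idem i, ← 𝓑.form_assoc, h1, map_zero]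
  · rw [← h.idem_mul_idem i, ← 𝓑.form_assoc, h2, map_zero]
  · rw [← h.idem_mul_idem i, 𝓑.form_assoc, mul_comm, h2, map_zero, LinearMap.zero_apply]
  · have f1 := h.form_ne i j 1 1 hij
    have f2 := h.form_ne i j 1 (-1) hij
    have f3 := h.form_ne i j (-1) 1 hij
    have f4 := h.form_ne i j (-1) (-1) hij
    apply mul_cancel_of_real (n := 64) (by norm_num)
    simp only [axisDiff, map_sub, LinearMap.sub_apply]
    push_cast
    linear_combination f1 - f2 - f3 + f4

theorem homMap_form (x y : Model4B) :
    𝓑.form (homMap 𝓑 c x) (homMap 𝓑 c y) = algebraMap ℝ 𝓑.R (Model4B.form x y) := by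
  have i01 := h.form_of_ne (i := 0) (j := 1) (by decide)
  have i02 := h.form_of_ne (i := 0) (j := 2) (by decide)
  have i10 := h.form_of_ne (i := 1) (j := 0) (by decide)
  have i12 := h.form_of_ne (i := 1) (j := 2) (by decide)
  have i20 := h.form_of_ne (i := 2) (j := 0) (by decide)
  have i21 := h.form_of_ne (i := 2) (j := 1) (by decide)
  simp only [homMap_apply, Model4B.form_apply, map_add, map_mul, map_smul, LinearMap.add_apply,
    LinearMap.smul_apply, Fin.sum_univ_three, smul_eq_mul, i01, i02, i10, i12, i20, i21,
    h.form_idem_diff, h.form_idem_idem, h.form_diff_diff, h.form_idem_c, h.form_diff_c, h.form_c]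
  ring

/-- The morphism from the universal algebra. -/
noncomputable def hom : MarkedFrobeniusAlgebra.Hom universal4B 𝓑 where
  ringMap := Algebra.ofId ℝ 𝓑.R
  map := homMap 𝓑 c
  map_smul := homMap_smul
  map_mul := h.homMap_mul
  map_form := h.homMap_form
  map_gen := homMap_axis

end Form

end HasTable4B

/-! ### Surjectivity and uniqueness of morphisms. -/

namespace MarkedFrobeniusAlgebra.Hom

variable {ι : Type} {𝓐 : MarkedFrobeniusAlgebra.{u} ι} {𝓑 : MarkedFrobeniusAlgebra.{v} ι}

/-- Products of marked generators lift, so their form values, which generate the target ring over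
`ℝ`, lie in the image. -/
theorem surjective_ringMap (f : Hom 𝓐 𝓑) : Function.Surjective f.ringMap := by
  have hcl : ∀ x ∈ Subsemigroup.closure (Set.range 𝓑.gen), ∃ y, f.map y = x := by
    intro x hx
    induction hx using Subsemigroup.closure_induction with
    | mem x hx =>
      obtain ⟨i, rfl⟩ := hx
      exact ⟨_, f.map_gen i⟩
    | mul x y _ _ hx hy =>
      obtain ⟨x', rfl⟩ := hx
      obtain ⟨y', rfl⟩ := hy
      exact ⟨_, f.map_mul x' y'⟩
  rw [← AlgHom.range_eq_top, eq_top_iff, ← 𝓑.adjoin_form, Algebra.adjoin_le_iff]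
  rintro r ⟨x, hx, y, hy, rfl⟩
  obtain ⟨x', rfl⟩ := hcl x hx
  obtain ⟨y', rfl⟩ := hcl y hy
  exact ⟨_, (f.map_form x' y').symm⟩

/-- The range is stable under scalars of the target because these lift along the surjective ring
map; it then is a subalgebra containing the generators. -/
theorem surjective_map (f : Hom 𝓐 𝓑) : Function.Surjective f.map := by
  let S : NonUnitalSubalgebra 𝓑.R 𝓑.M :=
    { carrier := Set.range f.map
      add_mem' := by
        rintro _ _ ⟨x, rfl⟩ ⟨y, rfl⟩
        exact ⟨x + y, map_add _ _ _⟩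
      zero_mem' := ⟨0, map_zero _⟩
      mul_mem' := by
        rintro _ _ ⟨x, rfl⟩ ⟨y, rfl⟩
        exact ⟨x * y, f.map_mul _ _⟩
      smul_mem' := by
        rintro r _ ⟨x, rfl⟩
        obtain ⟨s, rfl⟩ := f.surjective_ringMap r
        exact ⟨s • x, f.map_smul _ _⟩ }
  have hS : NonUnitalAlgebra.adjoin 𝓑.R (Set.range 𝓑.gen) ≤ S := by
    apply NonUnitalAlgebra.adjoin_le
    rintro _ ⟨i, rfl⟩
    exact ⟨_, f.map_gen i⟩
  rw [𝓑.adjoin_gen] at hS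
  exact fun x => hS (x := x) trivial

theorem eq_of_ringMap_eq {f g : Hom 𝓐 𝓑} (h : f.ringMap = g.ringMap) : f = g := by
  let S : NonUnitalSubalgebra 𝓐.R 𝓐.M :=
    { carrier := {x | f.map x = g.map x}
      add_mem' := by
        intro x y hx hy
        simp only [Set.mem_ofPred_eq, map_add] at *
        rw [hx, hy]
      zero_mem' := by simp
      mul_mem' := by
        intro x y hx hy
        simp only [Set.mem_ofPred_eq, f.map_mul, g.map_mul] at *
        rw [hx, hy]
      smul_mem' := by
        intro r x hx
        simp only [Set.mem_ofPred_eq, f.map_smul, g.map_smul] at *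
        rw [hx, h] }
  have hS : NonUnitalAlgebra.adjoin 𝓐.R (Set.range 𝓐.gen) ≤ S := by
    apply NonUnitalAlgebra.adjoin_le
    rintro _ ⟨i, rfl⟩
    exact (f.map_gen i).trans (g.map_gen i).symm
  rw [𝓐.adjoin_gen] at hS
  exact Hom.ext h (AddMonoidHom.ext fun x => hS (x := x) trivial)

end MarkedFrobeniusAlgebra.Hom

/-! ### The universal property and the basis. -/

theorem isUniversal4B_universal4B : IsUniversal4B.{0, v} universal4B := by
  refine ⟨isShape4B_universal4B, fun 𝓑 h𝓑 => ?_⟩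
  obtain ⟨c, hc⟩ := h𝓑.exists_table
  refine ⟨hc.hom, hc.hom.surjective_ringMap, hc.hom.surjective_map, fun g => ?_⟩
  apply MarkedFrobeniusAlgebra.Hom.eq_of_ringMap_eq
  exact Subsingleton.elim (α := ℝ →ₐ[ℝ] 𝓑.R) _ _

theorem Model4B.linearIndependent_axis :
    LinearIndependent ℝ (fun o : Option AxisIndex => o.elim Model4B.rho Model4B.axis) := by
  rw [Fintype.linearIndependent_iff]
  intro g hg
  rw [Fintype.sum_option, Fintype.sum_prod_type] at hg
  have key : ∀ j, g (some (j, 1)) = 0 ∧ g (some (j, -1)) = 0 := by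
    intro j
    have h1 := congrArg (Model4B.φ j) hg
    have h2 := congrArg (Model4B.δ j) hg
    simp only [UnitsInt.univ, Option.elim, map_add, map_sum, map_smul, Model4B.rho, Model4B.φ_mk,
      Model4B.δ_mk, Model4B.φ_axis, Model4B.δ_axis, Finset.sum_pair (show (1 : ℤˣ) ≠ -1 by decide),
      smul_eq_mul, mul_ite, mul_zero, Pi.zero_apply, ← ite_add_zero, Finset.sum_ite_eq,
      Finset.mem_univ, if_true, map_zero, Units.val_one, Units.val_neg, Int.cast_one,
      Int.cast_neg] at h1 h2
    constructor <;> linarith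
  have h3 := congrArg Model4B.γ hg
  rintro (_ | ⟨j, d⟩)
  · simpa [UnitsInt.univ, (key _).1, (key _).2, Model4B.rho] using h3
  · rcases Int.units_eq_one_or d with rfl | rfl
    · exact (key j).1
    · exact (key j).2

theorem theorem4p1 :
    (∃ 𝓐 : MarkedFrobeniusAlgebra.{0} AxisIndex, IsUniversal4B.{0, v} 𝓐) ∧
    ∀ 𝓐 : MarkedFrobeniusAlgebra.{u} AxisIndex, IsUniversal4B.{u, v} 𝓐 →
      Function.Bijective (algebraMap ℝ 𝓐.R) ∧
      Module.finrank 𝓐.R 𝓐.M = 7 ∧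
      ∃ b : Module.Basis (Option AxisIndex) 𝓐.R 𝓐.M,
        (∀ i, b (some i) = 𝓐.gen i) ∧ b none = aRho 𝓐 := by
  refine ⟨⟨universal4B, isUniversal4B_universal4B⟩, fun 𝓐 h => ?_⟩
  obtain ⟨c, hc⟩ := h.1.exists_table
  have hbij : Function.Bijective (algebraMap ℝ 𝓐.R) :=
    ⟨(algebraMap ℝ 𝓐.R).injective, hc.hom.surjective_ringMap⟩
  have hrho : HasTable4B.homMap 𝓐 c Model4B.rho = c := by
    simp [HasTable4B.homMap_apply, Model4B.rho]
  have hc' : c = aRho 𝓐 := by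
    have := hc.mul_neg 0 1
    rw [aRho, this]; abel
  -- The map preserves the form and `ℝ` embeds into the coefficient ring, so `⟨x, x⟩ = 0` already in
  -- the model.
  have hinj : ∀ x, HasTable4B.homMap 𝓐 c x = 0 → x = 0 := by
    intro x hx
    apply Model4B.form_self_eq_zero
    apply hbij.1
    rw [← hc.homMap_form, hx]
    simp
  have hli : LinearIndependent 𝓐.R (fun o : Option AxisIndex =>
      HasTable4B.homMap 𝓐 c (o.elim Model4B.rho Model4B.axis)) :=
    Model4B.linearIndependent_axis.map_of_surjective_injective (algebraMap ℝ 𝓐.R)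
      (HasTable4B.homMap 𝓐 c) hbij.2 hinj HasTable4B.homMap_smul
  have hspan : ⊤ ≤ Submodule.span 𝓐.R (Set.range (fun o : Option AxisIndex =>
      HasTable4B.homMap 𝓐 c (o.elim Model4B.rho Model4B.axis))) := by
    rintro y -
    obtain ⟨x, rfl⟩ := hc.hom.surjective_map y
    change HasTable4B.homMap 𝓐 c x ∈ _
    have hm : ∀ (o : Option AxisIndex) (r : ℝ), HasTable4B.homMap 𝓐 c
        (r • o.elim Model4B.rho Model4B.axis) ∈ Submodule.span 𝓐.R (Set.range
          (fun o : Option AxisIndex =>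
            HasTable4B.homMap 𝓐 c (o.elim Model4B.rho Model4B.axis))) := by
      intro o r
      rw [HasTable4B.homMap_smul]
      exact Submodule.smul_mem _ _ (Submodule.subset_span ⟨o, rfl⟩)
    rw [Model4B.eq_sum x, map_add, map_sum]
    refine add_mem (sum_mem fun j _ => ?_) (hm none _)
    rw [map_add]
    exact add_mem (hm (some (j, 1)) _) (hm (some (j, -1)) _)
  let b := Module.Basis.mk hli hspan
  refine ⟨hbij, ?_, b, fun i => ?_, ?_⟩
  · rw [Module.finrank_eq_card_basis b]
    rfl
  · rw [Module.Basis.mk_apply]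
    exact HasTable4B.homMap_axis i
  · rw [Module.Basis.mk_apply, ← hc', ← hrho]
    simp [hrho]
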